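/- Let $\mathcal X\subseteq\mathbb R^{m}$ (contexts, with some norm $\|\cdot\|$ on $\mathbb R^m$) and $\mathcal A\subseteq\mathbb R^{m'}$ (arms), and let $\mathcal H$ be a reproducing kernel Hilbert space of real functions on $\mathcal X\times\mathcal A$ with measurable kernel $k$ satisfying $k(z,z)\le 1$ for all $z$. Let $f\in\mathcal H$ with $\|f\|_{\mathcal H}\le B$, and for every $x\in\mathcal X$ let $A^*(x)\in\arg\max_{a\in\mathcal A}f(x,a)$. Fix $\lambda\ge1$, $b\ge0$, $\delta\in(0,1)$, $\Delta\in\mathbb R$, $T\in\mathbb N$, and put $\mathcal B_\Delta(\hat x)=\{y\in\mathcal X:\|y-\hat x\|\le\Delta\}$. In round $t=1,\dots,T$ the agent receives an imperfect context $\hat x_t\in\mathcal X$ and selects an arm $a_t\in\mathcal A$; then the true context $x_t\in\mathcal B_\Delta(\hat x_t)$ and the reward $y_t=f(x_t,a_t)+n_t$ are revealed. The contexts may be arbitrary and random. The noise is conditionally $b$-sub-Gaussian: for all $\sigma\in\mathbb R$, $e^{\sigma n_t}$ is integrable and $$\mathbb E\big[e^{\sigma n_t}\,\big|\,x_1,a_1,\dots,x_t,a_t,\;y_1,\dots,y_{t-1}\big]\le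 e^{\sigma^2b^2/2}\quad\text{almost surely.}$$ For $z=(x,a)$ and $z_\tau=(x_\tau,a_\tau)$ let $\mathbf K_t=(k(z_\tau,z_{\tau'}))_{1\le\tau,\tau'\le t-1}$, $\mathbf k_t(z)=(k(z,z_\tau))_{1\le\tau\le t-1}$, $\mathbf y_t=(y_\tau)_{1\le\tau\le t-1}$ and $$\hat f_t(z)=\mathbf k_t(z)^\top(\mathbf K_t+\lambda\mathbf I)^{-1}\mathbf y_t,\qquad s_t(z)^2=\tfrac1\lambda k(z,z)-\tfrac1\lambda\mathbf k_t(z)^\top(\mathbf K_t+\lambda\mathbf I)^{-1}\mathbf k_t(z),$$ $$\gamma_t=\log\det(\mathbf I+\mathbf K_t/\lambda),\qquad h_t=\sqrt\lambda\,B+b\sqrt{\gamma_t-2\log\delta},\qquad U_t(z)=\hat f_t(z)+h_ts_t(z).$$ Suppose the arms are selected by MaxMinUCB, that is, $a_t\in\arg\max_{a\in\mathcal A}\min_{x\in\mathcal B_\Delta(\hat x_t)}U_t(x,a)$ for $t=1,\dots,T$. Then with probability at least $1-\delta$ the cumulative true regret $R_T=\sum_{t=1}^T\big[f(x_t,A^*(x_t))-f(x_t,a_t)\big]$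 satisfies $$R_T\le\sum_{t=1}^T\overline{MR}_t+2h_T\sqrt{2T\bar d\log\Big(1+\frac{T}{\bar d\lambda}\Big)},$$ where $$\overline{MR}_t=\max_{x\in\mathcal B_\Delta(\hat x_t)}f(x,A^*(x))-MF_t,\qquad MF_t=\max_{a\in\mathcal A}\min_{x\in\mathcal B_\Delta(\hat x_t)}f(x,a),$$ and $\bar d$ is the rank of the $T\times T$ Gram matrix $\mathbf K_{T+1}=(k(z_\tau,z_{\tau'}))_{1\le\tau,\tau'\le T}$ (the square root is read as $0$ if $\bar d=0$). Maxima and minima over contexts, and the maximum in $MF_t$, are read as suprema and infima when not attained. -/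

import Mathlib

open MeasureTheory

namespace RobustBandit

noncomputable section

/-! ### Kernel ridge regression

`z 1, z 2, …` are the context-arm pairs `[x_τ, a_τ]` of the rounds, `y 1, y 2, …` the rewards.
The quantities of round `t` use the `t - 1` observations of the rounds `1, …, t - 1`. -/

section Regression

variable {Z : Type*} (k : Z → Z → ℝ) (z : ℕ → Z) (y : ℕ → ℝ) (lam B b δ : ℝ)

/-- The Gram matrix `K_t`, of size `(t-1) × (t-1)`, of the rounds `1, …, t-1`. -/
def gram (t : ℕ) : Matrix (Fin (t - 1)) (Fin (t - 1)) ℝ :=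
  Matrix.of fun i j => k (z (i + 1)) (z (j + 1))

/-- The vector `k_t(p) ∈ ℝ^(t-1)`. -/
def kvec (t : ℕ) (p : Z) : Fin (t - 1) → ℝ := fun i => k p (z (i + 1))

/-- The vector `y_t ∈ ℝ^(t-1)` of past rewards. -/
def yvec (t : ℕ) : Fin (t - 1) → ℝ := fun i => y (i + 1)

/-- The kernel ridge regression estimate `k_t(p)ᵀ (K_t + λ I)⁻¹ y_t`. -/
def fhat (t : ℕ) (p : Z) : ℝ :=
  kvec k z t p ⬝ᵥ (Matrix.mulVec (gram k z t + lam • (1 : Matrix _ _ ℝ))⁻¹ (yvec y t))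

/-- The squared confidence width `s_t(p)²`. -/
def widthSq (t : ℕ) (p : Z) : ℝ :=
  (1 / lam) * k p p - (1 / lam) * (kvec k z t p ⬝ᵥ
    (Matrix.mulVec (gram k z t + lam • (1 : Matrix _ _ ℝ))⁻¹ (kvec k z t p)))

/-- The confidence width `s_t(p)`. -/
def width (t : ℕ) (p : Z) : ℝ := √(widthSq k z lam t p)

/-- `γ_t = log det (I + K_t / λ)`. -/
def infoGain (t : ℕ) : ℝ :=
  Real.log (Matrix.det ((1 : Matrix _ _ ℝ) + (1 / lam) • gram k z t))

/-- `h_t = √λ B + b √(γ_t - 2 log δ)`. -/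
def hcoef (t : ℕ) : ℝ := √lam * B + b * √(infoGain k z lam t - 2 * Real.log δ)

/-- The reward upper confidence bound `U_t(p)`. -/
def ucb (t : ℕ) (p : Z) : ℝ :=
  fhat k z y lam t p + hcoef k z lam B b δ t * width k z lam t p

end Regression

/-! ### Contexts, arms, robustness -/

/-- The neighbourhood `{x ∈ 𝒳 : ‖x - x̂‖ ≤ Δ}` of a received context. -/
def ball {E : Type*} [NormedAddCommGroup E] {𝒳 : Set E} (Δ : ℝ) (xhat : 𝒳) : Set 𝒳 :=
  {x | ‖(x : E) - (xhat : E)‖ ≤ Δ}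

section Robust

variable {X A : Type*}

/-- `Astar x` is, for every context `x`, an arm with the largest reward `f (x, ·)`. -/
def IsOracle (f : X × A → ℝ) (Astar : X → A) : Prop :=
  ∀ x a, f (x, a) ≤ f (x, Astar x)

/-- `a` maximizes the minimum of `U (x, a)` over the contexts `x ∈ S`. -/
def IsMaxMinArm (U : X × A → ℝ) (S : Set X) (a : A) : Prop :=
  ∀ a' : A, (⨅ x : S, U (x, a')) ≤ ⨅ x : S, U (x, a)

/-- The optimal worst-case reward `max_a min_{x ∈ S} f (x, a)`. -/
def MF (f : X × A → ℝ) (S : Set X) : ℝ := ⨆ a : A, ⨅ x : S, f (x, a)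

/-- `max_{x ∈ S} f (x, A*(x))` minus the optimal worst-case reward. -/
def MRbar (f : X × A → ℝ) (Astar : X → A) (S : Set X) : ℝ :=
  (⨆ x : S, f (x, Astar x)) - MF f S

end Robust

/-- The information available just before the reward of round `t` is drawn: the true contexts and
the selected arms of the rounds `1, …, t` and the rewards of the rounds `1, …, t-1`. -/
@[reducible] def information {Ω X A : Type*} [MeasurableSpace X] [MeasurableSpace A]
    (x : ℕ → Ω → X) (a : ℕ → Ω → A) (y : ℕ → Ω → ℝ) (t : ℕ) : MeasurableSpace Ω :=
  (⨆ τ ∈ Finset.Icc 1 t, MeasurableSpace.comap (fun ω => (x τ ω, a τ ω)) inferInstance) ⊔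
    ⨆ τ ∈ Finset.Icc 1 (t - 1), MeasurableSpace.comap (y τ) inferInstance

/-- Conditionally on `m`, the random variable `n` is `b`-sub-Gaussian. -/
def CondSubGaussian {Ω : Type*} [mΩ : MeasurableSpace Ω] (P : Measure Ω)
    (m : MeasurableSpace Ω) (n : Ω → ℝ) (b : ℝ) : Prop :=
  ∀ σ : ℝ, Integrable (fun ω => Real.exp (σ * n ω)) P ∧
    ∀ᵐ ω ∂P, (P[fun ω => Real.exp (σ * n ω) | m]) ω ≤ Real.exp (σ ^ 2 * b ^ 2 / 2)

/-- The scalar kernel of a reproducing kernel Hilbert space of real functions. -/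
def scalarKernel (H : Type*) {Z : Type*} [NormedAddCommGroup H] [InnerProductSpace ℝ H]
    [CompleteSpace H] [RKHS ℝ H Z ℝ] (p q : Z) : ℝ :=
  RKHS.kernel H p q 1

end

end RobustBandit

open RobustBandit

/-!
The argument is the optimism principle for kernel ridge regression, with the feature map
`φ p = k(p, ·)` of the reproducing kernel Hilbert space, so that `k(p, q) = ⟪φ p, φ q⟫` and
`f p = ⟪f, φ p⟫`.

*Confidence.* The error of the ridge estimate at `p` is a bias plus a noise term. By Cauchy-Schwarz
for the form `λ ⟪·, ·⟫ + ∑ ⟪v i, ·⟫ ⟪v i, ·⟫` both are multiples of the width `s_t(p)`, with factors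
`√λ ‖f‖` and `√(ηᵀ K (K + λ I)⁻¹ η)`, where `η` is the noise vector (`abs_inner_sub_ridgeMean_le`).

*Concentration.* For noise of scale one, `exp ((ηᵀ K (K + λ I)⁻¹ η - log det (I + K / λ)) / 2)` is a
supermartingale (`expMart`). The usual reason is that it is the mixture of the exponentials
`exp ∑ (g(z_τ) η_τ - g(z_τ)² / 2)` over a Gaussian process `g`. Here no process is needed: when a row
is added to the Gram matrix, a Schur complement (`det_one_add_gram_succ`, `noiseEnergy_succ`) shows
that the supermartingale is multiplied by a one-dimensional Gaussian mixture whose mean and variance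
are already known, and Tonelli's theorem bounds its conditional mean by one
(`lintegral_mul_mixtureFactor_le`). Ville's inequality then gives the confidence bound for all rounds
at once (`exists_sqrt_noiseEnergy_le`).

*Regret.* Where the confidence bounds hold, the optimistic value of the selected arm dominates the
optimal worst-case reward, so a round costs at most `MRbar` plus twice the confidence width
(`regret_le_of_isMaxMinArm`). The squared widths sum to at most `2 log det (I + K_{T+1} / λ)`
(`sum_width_le`), and concavity of the logarithm bounds this determinant by the rank and the trace
of the Gram matrix (`log_det_one_add_smul_le`).
-/

namespace RobustBandit

open Matrix ProbabilityTheory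
open scoped ENNReal NNReal

/-! ### Ridge regression in an inner product space -/

section LinearAlgebra

variable {H : Type*} [NormedAddCommGroup H] [InnerProductSpace ℝ H]

/-- The regularized Gram matrix `K + λ I` of a finite family of feature vectors. -/
noncomputable def ridgeMatrix {ι : Type*} [DecidableEq ι] (lam : ℝ) (v : ι → H) : Matrix ι ι ℝ :=
  Matrix.gram ℝ v + lam • (1 : Matrix ι ι ℝ)

/-- The vector of inner products of `φ` with a family of feature vectors. -/
def innerVec {ι : Type*} (v : ι → H) (φ : H) : ι → ℝ := fun i => inner ℝ φ (v i)

variable {ι : Type*} [Fintype ι]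

theorem gram_mulVec (v : ι → H) (w : ι → ℝ) :
    Matrix.gram ℝ v *ᵥ w = innerVec v (∑ j, w j • v j) := by
  ext i
  simp [innerVec, mulVec, dotProduct, sum_inner, inner_smul_left, real_inner_comm, mul_comm]

theorem innerVec_dotProduct (v : ι → H) (φ : H) (w : ι → ℝ) :
    innerVec v φ ⬝ᵥ w = inner ℝ φ (∑ j, w j • v j) := by
  simp [innerVec, dotProduct, inner_sum, inner_smul_right, mul_comm]

theorem dotProduct_sq_le (α β : ι → ℝ) : (α ⬝ᵥ β) ^ 2 ≤ (α ⬝ᵥ α) * (β ⬝ᵥ β) := by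
  simpa [dotProduct, pow_two] using Finset.sum_mul_sq_le_sq_mul_sq Finset.univ α β

variable [DecidableEq ι]

/-- The squared confidence width `λ⁻¹ (‖φ‖² - κᵀ (K + λ I)⁻¹ κ)` in the direction `φ`. It is the
conditional variance of a Gaussian process with covariance `λ⁻¹ ⟪·, ·⟫` that is observed at the
feature vectors with unit noise. -/
noncomputable def ridgeVar (lam : ℝ) (v : ι → H) (φ : H) : ℝ :=
  (1 / lam) * inner ℝ φ φ -
    (1 / lam) * (innerVec v φ ⬝ᵥ ((ridgeMatrix lam v)⁻¹ *ᵥ innerVec v φ))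

/-- The ridge regression estimate `κᵀ (K + λ I)⁻¹ η` in the direction `φ` from the data `η`. -/
noncomputable def ridgeMean (lam : ℝ) (v : ι → H) (η : ι → ℝ) (φ : H) : ℝ :=
  innerVec v φ ⬝ᵥ ((ridgeMatrix lam v)⁻¹ *ᵥ η)

/-- The squared self-normalized norm `ηᵀ K (K + λ I)⁻¹ η` of the noise vector `η`, written with
`K = (K + λ I) - λ I`. -/
noncomputable def noiseEnergy (lam : ℝ) (v : ι → H) (η : ι → ℝ) : ℝ :=
  η ⬝ᵥ η - lam * (η ⬝ᵥ ((ridgeMatrix lam v)⁻¹ *ᵥ η))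

theorem posDef_ridgeMatrix {lam : ℝ} (hlam : 0 < lam) (v : ι → H) :
    (ridgeMatrix lam v).PosDef :=
  PosDef.posSemidef_add (Matrix.posSemidef_gram ℝ v) (PosDef.one.smul hlam)

theorem isUnit_det_ridgeMatrix {lam : ℝ} (hlam : 0 < lam) (v : ι → H) :
    IsUnit (ridgeMatrix lam v).det :=
  (posDef_ridgeMatrix hlam v).det_pos.ne'.isUnit

theorem ridgeMatrix_mulVec_inv {lam : ℝ} (hlam : 0 < lam) (v : ι → H) (η : ι → ℝ) :
    ridgeMatrix lam v *ᵥ ((ridgeMatrix lam v)⁻¹ *ᵥ η) = η := by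
  rw [mulVec_mulVec, mul_nonsing_inv _ (isUnit_det_ridgeMatrix hlam v), one_mulVec]

theorem inv_ridgeMatrix_mulVec_eq {lam : ℝ} (hlam : 0 < lam) (v : ι → H) {η w : ι → ℝ}
    (h : ridgeMatrix lam v *ᵥ w = η) : (ridgeMatrix lam v)⁻¹ *ᵥ η = w := by
  rw [← h, mulVec_mulVec, nonsing_inv_mul _ (isUnit_det_ridgeMatrix hlam v), one_mulVec]

theorem ridgeMatrix_mulVec (lam : ℝ) (v : ι → H) (w : ι → ℝ) :
    ridgeMatrix lam v *ᵥ w = Matrix.gram ℝ v *ᵥ w + lam • w := by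
  simp [ridgeMatrix, add_mulVec, smul_mulVec]

theorem innerVec_eq_of_ridge {lam : ℝ} (hlam : 0 < lam) (v : ι → H) (η : ι → ℝ) :
    innerVec v (∑ j, ((ridgeMatrix lam v)⁻¹ *ᵥ η) j • v j) +
      lam • ((ridgeMatrix lam v)⁻¹ *ᵥ η) = η := by
  rw [← gram_mulVec, ← ridgeMatrix_mulVec, ridgeMatrix_mulVec_inv hlam]

theorem ridgeMean_eq_dotProduct {lam : ℝ} (hlam : 0 < lam) (v : ι → H) (η : ι → ℝ) (φ : H) :
    ridgeMean lam v η φ = η ⬝ᵥ ((ridgeMatrix lam v)⁻¹ *ᵥ innerVec v φ) := by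
  have hT : ((ridgeMatrix lam v)⁻¹)ᵀ = (ridgeMatrix lam v)⁻¹ :=
    (conjTranspose_eq_transpose_of_trivial _).symm.trans
      (posDef_ridgeMatrix hlam v).isHermitian.inv
  rw [ridgeMean, dotProduct_mulVec, ← mulVec_transpose, hT, dotProduct_comm]

/-- The squared width is the value at its minimizer of the regularized squared distance from `φ`
to the span of the feature vectors. -/
theorem ridgeVar_eq {lam : ℝ} (hlam : 0 < lam) (v : ι → H) (φ : H) :
    ridgeVar lam v φ =
      ‖φ - ∑ j, ((ridgeMatrix lam v)⁻¹ *ᵥ innerVec v φ) j • v j‖ ^ 2 / lam +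
      ((ridgeMatrix lam v)⁻¹ *ᵥ innerVec v φ) ⬝ᵥ ((ridgeMatrix lam v)⁻¹ *ᵥ innerVec v φ) := by
  have h := innerVec_eq_of_ridge hlam v (innerVec v φ)
  unfold ridgeVar
  set α := (ridgeMatrix lam v)⁻¹ *ᵥ innerVec v φ
  set p := ∑ j, α j • v j
  have h1 : innerVec v φ ⬝ᵥ α = inner ℝ p p + lam * (α ⬝ᵥ α) := by
    rw [← h, add_dotProduct, innerVec_dotProduct, smul_dotProduct, smul_eq_mul]
  have h2 : innerVec v φ ⬝ᵥ α = inner ℝ φ p := innerVec_dotProduct v φ α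
  rw [← real_inner_self_eq_norm_sq, inner_sub_left, inner_sub_right, inner_sub_right,
    real_inner_comm φ p, ← h2, h1]
  field_simp
  linarith

theorem ridgeVar_nonneg {lam : ℝ} (hlam : 0 < lam) (v : ι → H) (φ : H) :
    0 ≤ ridgeVar lam v φ := by
  rw [ridgeVar_eq hlam]
  have := dotProduct_self_star_nonneg ((ridgeMatrix lam v)⁻¹ *ᵥ innerVec v φ)
  simp only [star_trivial] at this
  positivity

theorem ridgeVar_le {lam : ℝ} (hlam : 0 < lam) (v : ι → H) (φ : H) :
    ridgeVar lam v φ ≤ (1 / lam) * inner ℝ φ φ := by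
  have := (posDef_ridgeMatrix hlam v).inv.posSemidef.dotProduct_mulVec_nonneg (innerVec v φ)
  simp only [star_trivial] at this
  unfold ridgeVar
  have : 0 ≤ 1 / lam * (innerVec v φ ⬝ᵥ ((ridgeMatrix lam v)⁻¹ *ᵥ innerVec v φ)) := by positivity
  linarith

/-- In a direction of zero width there is nothing to estimate. -/
theorem ridgeMean_eq_zero {lam : ℝ} (hlam : 0 < lam) (v : ι → H) (η : ι → ℝ) (φ : H)
    (h : ridgeVar lam v φ = 0) : ridgeMean lam v η φ = 0 := by
  rw [ridgeVar_eq hlam] at h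
  have h0 := dotProduct_self_star_nonneg ((ridgeMatrix lam v)⁻¹ *ᵥ innerVec v φ)
  simp only [star_trivial] at h0
  have h1 : ((ridgeMatrix lam v)⁻¹ *ᵥ innerVec v φ) ⬝ᵥ
      ((ridgeMatrix lam v)⁻¹ *ᵥ innerVec v φ) = 0 :=
    le_antisymm (h ▸ le_add_of_nonneg_left (by positivity)) h0
  have h2 := ridgeMatrix_mulVec_inv hlam v (innerVec v φ)
  rw [dotProduct_self_eq_zero.mp h1, mulVec_zero] at h2
  rw [ridgeMean, ← h2, zero_dotProduct]

theorem noiseEnergy_eq {lam : ℝ} (hlam : 0 < lam) (v : ι → H) (η : ι → ℝ) :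
    noiseEnergy lam v η = lam * ‖∑ j, ((ridgeMatrix lam v)⁻¹ *ᵥ η) j • v j‖ ^ 2 +
      innerVec v (∑ j, ((ridgeMatrix lam v)⁻¹ *ᵥ η) j • v j) ⬝ᵥ
        innerVec v (∑ j, ((ridgeMatrix lam v)⁻¹ *ᵥ η) j • v j) := by
  have h := innerVec_eq_of_ridge hlam v η
  unfold noiseEnergy
  set w := (ridgeMatrix lam v)⁻¹ *ᵥ η
  set u := ∑ j, w j • v j
  rw [← real_inner_self_eq_norm_sq]
  have h1 : innerVec v u ⬝ᵥ w = inner ℝ u u := innerVec_dotProduct v u w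
  rw [← h]
  simp only [add_dotProduct, dotProduct_add, smul_dotProduct, dotProduct_smul, smul_eq_mul,
    dotProduct_comm w (innerVec v u), h1]
  ring

theorem noiseEnergy_smul (lam c : ℝ) (v : ι → H) (η : ι → ℝ) :
    noiseEnergy lam v (c • η) = c ^ 2 * noiseEnergy lam v η := by
  simp only [noiseEnergy, mulVec_smul, smul_dotProduct, dotProduct_smul, smul_eq_mul]
  ring

/-- Cauchy-Schwarz for the inner product `λ ⟪·, ·⟫ + ∑ ⟪v i, ·⟫ ⟪v i, ·⟫`, through which both the
width and the noise energy are expressed. -/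
theorem abs_ridgeMean_le {lam : ℝ} (hlam : 0 < lam) (v : ι → H) (η : ι → ℝ) (φ : H) :
    |ridgeMean lam v η φ| ≤ √(noiseEnergy lam v η) * √(ridgeVar lam v φ) := by
  have hw := innerVec_eq_of_ridge hlam v η
  have hα := innerVec_eq_of_ridge hlam v (innerVec v φ)
  rw [noiseEnergy_eq hlam, ridgeVar_eq hlam, ridgeMean]
  set w := (ridgeMatrix lam v)⁻¹ *ᵥ η
  set α := (ridgeMatrix lam v)⁻¹ *ᵥ innerVec v φ
  set u := ∑ j, w j • v j
  set p := ∑ j, α j • v j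
  have h1 : innerVec v φ ⬝ᵥ w = inner ℝ (φ - p) u + α ⬝ᵥ innerVec v u := by
    rw [innerVec_dotProduct, inner_sub_left, dotProduct_comm α, innerVec_dotProduct,
      real_inner_comm u p]
    ring
  have h2 := dotProduct_sq_le α (innerVec v u)
  have h3 := abs_real_inner_le_norm (φ - p) u
  have hα0 : 0 ≤ α ⬝ᵥ α := by simpa using dotProduct_self_star_nonneg α
  have hu0 : 0 ≤ innerVec v u ⬝ᵥ innerVec v u := by
    simpa using dotProduct_self_star_nonneg (innerVec v u)
  rw [h1, ← Real.sqrt_mul (by positivity)]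
  apply Real.abs_le_sqrt
  set X := ‖φ - p‖
  set Y := ‖u‖
  have hI : |α ⬝ᵥ innerVec v u| ≤ √(α ⬝ᵥ α) * √(innerVec v u ⬝ᵥ innerVec v u) := by
    rw [← Real.sqrt_mul hα0]; exact Real.abs_le_sqrt h2
  have hs : |inner ℝ (φ - p) u + α ⬝ᵥ innerVec v u| ≤
      X * Y + √(α ⬝ᵥ α) * √(innerVec v u ⬝ᵥ innerVec v u) :=
    (abs_add_le _ _).trans (add_le_add h3 hI)
  rw [← sq_abs]
  refine (pow_le_pow_left₀ (abs_nonneg _) hs 2).trans ?_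
  -- with `λ = l²` the defect in the Cauchy-Schwarz inequality is an explicit square
  obtain ⟨l, hl0, rfl⟩ : ∃ l : ℝ, 0 < l ∧ lam = l ^ 2 :=
    ⟨√lam, Real.sqrt_pos.mpr hlam, (Real.sq_sqrt hlam.le).symm⟩
  nth_rw 2 [← Real.sq_sqrt hu0]
  nth_rw 2 [← Real.sq_sqrt hα0]
  set a := √(α ⬝ᵥ α)
  set c := √(innerVec v u ⬝ᵥ innerVec v u)
  have : (l ^ 2 * Y ^ 2 + c ^ 2) * (X ^ 2 / l ^ 2 + a ^ 2) - (X * Y + a * c) ^ 2 =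
      (l * Y * a - c * X / l) ^ 2 := by
    field_simp
    ring
  nlinarith [sq_nonneg (l * Y * a - c * X / l)]

/-- The confidence bound of kernel ridge regression: a bias of size `√λ ‖f‖` and the
self-normalized noise, both measured in units of the width. -/
theorem abs_inner_sub_ridgeMean_le {lam : ℝ} (hlam : 0 < lam) (v : ι → H) (η : ι → ℝ) (f φ : H) :
    |inner ℝ f φ - ridgeMean lam v (fun i => inner ℝ f (v i) + η i) φ| ≤
      (√lam * ‖f‖ + √(noiseEnergy lam v η)) * √(ridgeVar lam v φ) := by
  set α := (ridgeMatrix lam v)⁻¹ *ᵥ innerVec v φ with hαdef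
  set p := ∑ j, α j • v j with hp
  have hsymm : ∀ ζ : ι → ℝ, ridgeMean lam v ζ φ = ζ ⬝ᵥ α :=
    fun ζ => ridgeMean_eq_dotProduct hlam v ζ φ
  have h1 : inner ℝ f φ - ridgeMean lam v (fun i => inner ℝ f (v i) + η i) φ =
      inner ℝ f (φ - p) - ridgeMean lam v η φ := by
    have hsplit : (fun i => inner ℝ f (v i) + η i) = innerVec v f + η := rfl
    rw [hsplit, hsymm, hsymm, add_dotProduct, innerVec_dotProduct, inner_sub_right]
    ring
  have h2 : ‖φ - p‖ ≤ √lam * √(ridgeVar lam v φ) := by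
    rw [← Real.sqrt_mul hlam.le]
    apply Real.le_sqrt_of_sq_le
    rw [ridgeVar_eq hlam, ← hαdef, ← hp]
    have h0 : 0 ≤ α ⬝ᵥ α := by simpa using dotProduct_self_star_nonneg α
    have : lam * (‖φ - p‖ ^ 2 / lam + α ⬝ᵥ α) = ‖φ - p‖ ^ 2 + lam * (α ⬝ᵥ α) := by
      field_simp
    rw [this]
    have : 0 ≤ lam * (α ⬝ᵥ α) := by positivity
    linarith
  rw [h1]
  calc |inner ℝ f (φ - p) - ridgeMean lam v η φ|
      ≤ |inner ℝ f (φ - p)| + |ridgeMean lam v η φ| := abs_sub _ _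
    _ ≤ ‖f‖ * (√lam * √(ridgeVar lam v φ)) +
        √(noiseEnergy lam v η) * √(ridgeVar lam v φ) :=
      add_le_add ((abs_real_inner_le_norm _ _).trans
        (mul_le_mul_of_nonneg_left h2 (norm_nonneg _))) (abs_ridgeMean_le hlam v η φ)
    _ = _ := by ring

end LinearAlgebra

/-! ### Adding a row to the Gram matrix -/

section Bordering

variable {H : Type*} [NormedAddCommGroup H] [InnerProductSpace ℝ H] {n : ℕ}

/-- The Schur complement of the bordered regularized Gram matrix is `λ (1 + s²)`. -/
theorem det_ridgeMatrix_succ {lam : ℝ} (hlam : 0 < lam) (v : Fin (n + 1) → H) :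
    (ridgeMatrix lam v).det = (ridgeMatrix lam fun i : Fin n => v i.castSucc).det *
      (lam * (1 + ridgeVar lam (fun i : Fin n => v i.castSucc) (v (Fin.last n)))) := by
  set v₀ : Fin n → H := fun i => v i.castSucc
  set φ := v (Fin.last n)
  have hblock : (ridgeMatrix lam v).submatrix finSumFinEquiv finSumFinEquiv =
      fromBlocks (ridgeMatrix lam v₀) (replicateCol (Fin 1) (innerVec v₀ φ))
        (replicateRow (Fin 1) (innerVec v₀ φ)) (of fun _ _ => inner ℝ φ φ + lam) := by
    ext i j
    rcases i with i | i <;> rcases j with j | j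
    · simp [ridgeMatrix, v₀, Matrix.one_apply, Fin.castAdd, Fin.castSucc]
    · obtain rfl : j = 0 := Subsingleton.elim _ _
      have : Fin.natAdd n (0 : Fin 1) = Fin.last n := rfl
      have h2 : Fin.castAdd 1 i = i.castSucc := rfl
      simp [ridgeMatrix, this, h2, v₀, φ, innerVec, real_inner_comm,
        (Fin.castSucc_lt_last i).ne]
    · obtain rfl : i = 0 := Subsingleton.elim _ _
      have : Fin.natAdd n (0 : Fin 1) = Fin.last n := rfl
      have h2 : Fin.castAdd 1 j = j.castSucc := rfl
      simp [ridgeMatrix, this, h2, v₀, φ, innerVec,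
        (Fin.castSucc_lt_last j).ne']
    · obtain rfl : i = 0 := Subsingleton.elim _ _
      obtain rfl : j = 0 := Subsingleton.elim _ _
      have : Fin.natAdd n (0 : Fin 1) = Fin.last n := rfl
      simp [ridgeMatrix, this, φ]
  rw [← det_submatrix_equiv_self finSumFinEquiv (ridgeMatrix lam v), hblock]
  have := invertibleOfIsUnitDet _ (isUnit_det_ridgeMatrix hlam v₀)
  rw [det_fromBlocks₁₁, det_fin_one, invOf_eq_nonsing_inv]
  congr 1
  have : (replicateRow (Fin 1) (innerVec v₀ φ) * (ridgeMatrix lam v₀)⁻¹ *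
      replicateCol (Fin 1) (innerVec v₀ φ)) 0 0 =
      innerVec v₀ φ ⬝ᵥ ((ridgeMatrix lam v₀)⁻¹ *ᵥ innerVec v₀ φ) := by
    rw [Matrix.mul_assoc, ← replicateCol_mulVec]
    simp [mul_apply, dotProduct]
  rw [Matrix.sub_apply, this, of_apply, ridgeVar]
  field_simp
  ring

theorem det_one_add_gram_succ {lam : ℝ} (hlam : 0 < lam) (v : Fin (n + 1) → H) :
    (1 + (1 / lam) • Matrix.gram ℝ v).det =
      (1 + (1 / lam) • Matrix.gram ℝ fun i : Fin n => v i.castSucc).det *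
      (1 + ridgeVar lam (fun i : Fin n => v i.castSucc) (v (Fin.last n))) := by
  have key : ∀ {m : ℕ} (u : Fin m → H),
      (1 + (1 / lam) • Matrix.gram ℝ u).det = (1 / lam) ^ m * (ridgeMatrix lam u).det := by
    intro m u
    have : 1 + (1 / lam) • Matrix.gram ℝ u = (1 / lam) • ridgeMatrix lam u := by
      rw [ridgeMatrix, smul_add, smul_smul, one_div, inv_mul_cancel₀ hlam.ne', one_smul, add_comm]
    rw [this, det_smul, Fintype.card_fin]
  rw [key, key, det_ridgeMatrix_succ hlam, pow_succ]
  field_simp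

/-- Observing the noise value `η_n` adds to the energy the gain in squared prediction error, the
residual being normalized by its predictive variance. -/
theorem noiseEnergy_succ {lam : ℝ} (hlam : 0 < lam) (v : Fin (n + 1) → H) (η : Fin (n + 1) → ℝ) :
    noiseEnergy lam v η =
      noiseEnergy lam (fun i : Fin n => v i.castSucc) (fun i => η i.castSucc) +
      η (Fin.last n) ^ 2 -
      (η (Fin.last n) - ridgeMean lam (fun i : Fin n => v i.castSucc) (fun i => η i.castSucc)
        (v (Fin.last n))) ^ 2 /
        (1 + ridgeVar lam (fun i : Fin n => v i.castSucc) (v (Fin.last n))) := by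
  set v₀ : Fin n → H := fun i => v i.castSucc with hv₀
  set η₀ : Fin n → ℝ := fun i => η i.castSucc with hη₀
  set φ := v (Fin.last n) with hφ
  set s := ridgeVar lam v₀ φ with hs
  set μ := ridgeMean lam v₀ η₀ φ with hμ
  have hs0 : 0 < 1 + s := by linarith [ridgeVar_nonneg hlam v₀ φ]
  -- the solution of the bordered linear system, by elimination of the last unknown
  set c := (η (Fin.last n) - μ) / (lam * (1 + s)) with hc
  set α := (ridgeMatrix lam v₀)⁻¹ *ᵥ innerVec v₀ φ with hα
  set w := (ridgeMatrix lam v₀)⁻¹ *ᵥ η₀ with hw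
  have hαs := innerVec_eq_of_ridge hlam v₀ (innerVec v₀ φ)
  have hws := innerVec_eq_of_ridge hlam v₀ η₀
  rw [← hα] at hαs
  rw [← hw] at hws
  have hκα : innerVec v₀ φ ⬝ᵥ α = inner ℝ φ φ - lam * s := by
    rw [hs, ridgeVar]; field_simp; ring
  have hsol : (ridgeMatrix lam v)⁻¹ *ᵥ η = Fin.snoc (w - c • α) c := by
    apply inv_ridgeMatrix_mulVec_eq hlam
    rw [ridgeMatrix_mulVec, gram_mulVec]
    have hsum : ∑ j, (Fin.snoc (w - c • α) c : Fin (n + 1) → ℝ) j • v j =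
        ∑ j, w j • v₀ j - c • ∑ j, α j • v₀ j + c • φ := by
      rw [Fin.sum_univ_castSucc]
      simp [sub_smul, Finset.sum_sub_distrib, Finset.smul_sum, smul_smul, hv₀, hφ]
    rw [hsum]
    ext i
    refine Fin.lastCases ?_ (fun i => ?_) i
    · simp only [Pi.add_apply, Pi.smul_apply, innerVec, Fin.snoc_last, smul_eq_mul,
        inner_add_left, inner_sub_left, inner_smul_left]
      rw [← hφ, real_inner_comm φ, ← innerVec_dotProduct, real_inner_comm φ (∑ j, α j • v₀ j),
        ← innerVec_dotProduct, hκα]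
      have : innerVec v₀ φ ⬝ᵥ w = μ := rfl
      rw [this, hc]
      simp only [conj_trivial]
      field_simp
      ring
    · have h1 := congrFun hαs i
      have h2 := congrFun hws i
      simp only [Pi.add_apply, Pi.smul_apply, innerVec, smul_eq_mul] at h1 h2
      simp only [Pi.add_apply, Pi.smul_apply, innerVec, Fin.snoc_castSucc, smul_eq_mul,
        inner_add_left, inner_sub_left, inner_smul_left, Pi.sub_apply, conj_trivial]
      have h3 : v i.castSucc = v₀ i := rfl
      have h4 : η i.castSucc = η₀ i := rfl
      rw [h3, h4]
      linear_combination h2 - c * h1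
  have hsymm : η₀ ⬝ᵥ α = μ := (ridgeMean_eq_dotProduct hlam v₀ η₀ φ).symm
  have hdot : ∀ ζ : Fin (n + 1) → ℝ, η ⬝ᵥ ζ =
      η₀ ⬝ᵥ (fun i => ζ i.castSucc) + η (Fin.last n) * ζ (Fin.last n) := by
    intro ζ
    simp [dotProduct, Fin.sum_univ_castSucc, hη₀]
  rw [noiseEnergy, noiseEnergy, hsol, hdot, hdot]
  simp only [Fin.snoc_castSucc, Fin.snoc_last]
  have h5 : (η₀ ⬝ᵥ fun i => (w - c • α) i) = η₀ ⬝ᵥ w - c * μ := by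
    have : (fun i => (w - c • α) i) = w - c • α := rfl
    rw [this, dotProduct_sub, dotProduct_smul, hsymm, smul_eq_mul]
  have h6 : (η₀ ⬝ᵥ fun i => η i.castSucc) = η₀ ⬝ᵥ η₀ := rfl
  rw [h5, h6, ← hw, hc]
  field_simp
  ring

end Bordering

/-! ### Log-determinant, rank and trace -/

section InformationGain

variable {ι : Type*} [Fintype ι] [DecidableEq ι]

/-- The determinant is the product of `1 + e / λ` over the nonzero eigenvalues `e`, of which there
are `rank K`. The bound follows from concavity of the logarithm: it lies below its tangent at
`1 + c / (d λ)`. -/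
theorem log_det_one_add_smul_le {lam : ℝ} (hlam : 0 < lam) {K : Matrix ι ι ℝ}
    (hK : K.PosSemidef) {c : ℝ} (hc : K.trace ≤ c) (hc0 : 0 ≤ c) :
    Real.log (1 + (1 / lam) • K).det ≤ K.rank * Real.log (1 + c / (K.rank * lam)) := by
  have hH := hK.isHermitian
  set e := hH.eigenvalues with he
  have hdet : (1 + (1 / lam) • K).det = ∏ i, (1 + e i / lam) := by
    have h1 : 1 + (1 / lam) • K = (-(1 / lam)) • (Matrix.scalar ι (-lam) - K) := by
      rw [smul_sub, Matrix.scalar_apply, ← Matrix.smul_one_eq_diagonal, smul_smul]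
      simp [hlam.ne']
    rw [h1, det_smul, ← Matrix.eval_charpoly, hH.charpoly_eq, Polynomial.eval_prod,
      ← Finset.card_univ, ← Finset.prod_const, ← Finset.prod_mul_distrib]
    refine Finset.prod_congr rfl fun i _ => ?_
    simp
    field_simp
    ring
  have he0 : ∀ i, 0 ≤ e i := hK.eigenvalues_nonneg
  set S := Finset.univ.filter fun i => e i ≠ 0
  have hcard : (K.rank : ℝ) = S.card := by
    rw [hH.rank_eq_card_non_zero_eigs, Fintype.card_subtype]
  have htr : ∑ i ∈ S, e i = K.trace := by
    rw [hH.trace_eq_sum_eigenvalues]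
    simp only [RCLike.ofReal_real_eq_id, id]
    exact Finset.sum_filter_ne_zero _
  rw [hdet, Real.log_prod fun i _ => by have := he0 i; positivity]
  have hS : ∑ i, Real.log (1 + e i / lam) = ∑ i ∈ S, Real.log (1 + e i / lam) := by
    refine (Finset.sum_subset (Finset.filter_subset _ _) fun i _ hi => ?_).symm
    have : e i = 0 := by simpa [S] using hi
    simp [this]
  rw [hS, hcard]
  rcases S.eq_empty_or_nonempty with hE | hne
  · -- at rank zero the fraction is `c / 0 = 0`, and both sides vanish
    simp [hE]
  have hd : 0 < (S.card : ℝ) := by exact_mod_cast hne.card_pos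
  set q := c / (S.card * lam) with hq
  have hq0 : 0 ≤ q := by positivity
  calc ∑ i ∈ S, Real.log (1 + e i / lam)
      ≤ ∑ i ∈ S, (Real.log (1 + q) + (e i / lam - q) / (1 + q)) := by
        refine Finset.sum_le_sum fun i _ => ?_
        have hi := he0 i
        have hpos : 0 < 1 + e i / lam := by positivity
        have h := Real.log_le_sub_one_of_pos (x := (1 + e i / lam) / (1 + q)) (by positivity)
        rw [Real.log_div hpos.ne' (by positivity)] at h
        have : (1 + e i / lam) / (1 + q) - 1 = (e i / lam - q) / (1 + q) := by
          field_simp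
          ring
        linarith
    _ = S.card * Real.log (1 + q) + (K.trace / lam - S.card * q) / (1 + q) := by
        rw [Finset.sum_add_distrib, ← Finset.sum_div, Finset.sum_sub_distrib, ← Finset.sum_div, htr]
        simp
    _ ≤ S.card * Real.log (1 + q) := by
        have : S.card * q = c / lam := by rw [hq]; field_simp
        rw [this, ← sub_div]
        have : (K.trace - c) / lam / (1 + q) ≤ 0 := by
          rw [div_div]
          exact div_nonpos_of_nonpos_of_nonneg (by linarith) (by positivity)
        linarith

end InformationGain

/-! ### A maximal inequality -/

section MaximalInequality

/-- Ville's maximal inequality for a nonnegative supermartingale over a finite horizon. -/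
theorem measure_exists_ge_le_of_supermartingale {Ω : Type*} {m0 : MeasurableSpace Ω}
    (P : Measure Ω) [IsProbabilityMeasure P] (F : ℕ → MeasurableSpace Ω)
    (hmono : Monotone F) (T : ℕ) (hF : ∀ n < T, F n ≤ m0) (M : ℕ → Ω → ℝ≥0∞)
    (hM : ∀ n < T, Measurable[F n] (M n)) (hM0 : ∀ ω, M 0 ω = 1)
    (hsuper : ∀ n < T, ∀ s, MeasurableSet[F n] s → ∫⁻ ω in s, M (n + 1) ω ∂P ≤
      ∫⁻ ω in s, M n ω ∂P) (c : ℝ≥0∞) :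
    c * P {ω | ∃ n < T, c ≤ M n ω} ≤ 1 := by
  have hmeas : ∀ N, N < T → MeasurableSet[F N] {ω | ∃ n < N + 1, c ≤ M n ω} := by
    intro N hN
    have : {ω | ∃ n < N + 1, c ≤ M n ω} = ⋃ n ∈ Finset.range (N + 1), {ω | c ≤ M n ω} := by
      ext ω; simp
    rw [this]
    refine Finset.measurableSet_biUnion _ fun n hn => ?_
    have hn' : n ≤ N := by simpa [Nat.lt_succ_iff] using hn
    exact hmono hn' _ (hM n (by omega) measurableSet_Ici)
  -- stop the process at its first passage above `c`
  have key : ∀ N ≤ T, c * P {ω | ∃ n < N, c ≤ M n ω} +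
      ∫⁻ ω in {ω | ∃ n < N, c ≤ M n ω}ᶜ, M N ω ∂P ≤ 1 := by
    intro N
    induction N with
    | zero => intro _; simp [hM0]
    | succ N ih =>
      intro hN
      have hNT : N < T := hN
      refine le_trans ?_ (ih hNT.le)
      set E := {ω | ∃ n < N, c ≤ M n ω} with hE
      set E' := {ω | ∃ n < N + 1, c ≤ M n ω} with hE'
      set D := Eᶜ ∩ {ω | c ≤ M N ω} with hD
      have hEm' : MeasurableSet E' := hF N hNT _ (hmeas N hNT)
      have hcm : MeasurableSet {ω | c ≤ M N ω} := hF N hNT _ (hM N hNT measurableSet_Ici)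
      have hEm : MeasurableSet E := by
        rcases Nat.eq_zero_or_pos N with rfl | hpos
        · simp [hE]
        · obtain ⟨k, rfl⟩ := Nat.exists_eq_succ_of_ne_zero hpos.ne'
          exact hF k (by omega) _ (hmeas k (by omega))
      have hEE : E' = E ∪ D := by
        ext ω
        simp only [hE', hE, hD, Set.mem_ofPred_eq, Set.mem_union, Set.mem_inter_iff,
          Set.mem_compl_iff, Nat.lt_succ_iff_lt_or_eq]
        constructor
        · rintro ⟨n, hn | rfl, h⟩
          · exact Or.inl ⟨n, hn, h⟩
          · by_cases h' : ∃ n' < n, c ≤ M n' ω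
            · exact Or.inl h'
            · exact Or.inr ⟨h', h⟩
        · rintro (⟨n, hn, h⟩ | ⟨-, h⟩)
          · exact ⟨n, Or.inl hn, h⟩
          · exact ⟨N, Or.inr rfl, h⟩
      have hDm : MeasurableSet D := hEm.compl.inter hcm
      have hdis : Disjoint E D := Set.disjoint_left.mpr fun ω h1 h2 => h2.1 h1
      have hcompl : Eᶜ = E'ᶜ ∪ D := by
        ext ω
        simp only [hEE, hD, Set.mem_compl_iff, Set.mem_union, Set.mem_inter_iff]
        tauto
      have hdis' : Disjoint E'ᶜ D := Set.disjoint_left.mpr fun ω h1 h2 =>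
        h1 (hEE ▸ Or.inr h2)
      have hPE : P E' = P E + P D := by rw [hEE, measure_union hdis hDm]
      rw [hcompl, lintegral_union hDm hdis', hPE, mul_add]
      have h1 : ∫⁻ ω in E'ᶜ, M (N + 1) ω ∂P ≤ ∫⁻ ω in E'ᶜ, M N ω ∂P :=
        hsuper N hNT _ (hmeas N hNT).compl
      have h2 : c * P D ≤ ∫⁻ ω in D, M N ω ∂P := by
        rw [← setLIntegral_const]
        exact setLIntegral_mono' hDm fun ω hω => hω.2
      calc c * P E + c * P D + ∫⁻ ω in E'ᶜ, M (N + 1) ω ∂P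
          ≤ c * P E + ∫⁻ ω in D, M N ω ∂P + ∫⁻ ω in E'ᶜ, M N ω ∂P := by gcongr
        _ = _ := by ring
  exact le_trans le_self_add (key T le_rfl)

end MaximalInequality

/-! ### Gaussian mixtures of sub-Gaussian exponentials -/

section SubGaussian

theorem CondSubGaussian.div {Ω : Type*} {m m0 : MeasurableSpace Ω} {P : Measure Ω}
    {ξ : Ω → ℝ} {b : ℝ} (hb : 0 < b) (h : CondSubGaussian P m ξ b) :
    CondSubGaussian P m (fun ω => ξ ω / b) 1 := by
  intro σ
  have hσ := h (σ / b)
  have h1 : (fun ω => Real.exp (σ * (ξ ω / b))) = fun ω => Real.exp (σ / b * ξ ω) := by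
    funext ω; congr 1; ring
  have h2 : σ ^ 2 * 1 ^ 2 / 2 = (σ / b) ^ 2 * b ^ 2 / 2 := by field_simp
  rw [h1, h2]
  exact hσ

variable {Ω : Type*} {m m0 : MeasurableSpace Ω} {P : Measure Ω} [IsProbabilityMeasure P]

/-- A bound on a conditional expectation given `m`, tested against `m`-measurable weights. -/
theorem lintegral_mul_le_of_condExp_le (hm : m ≤ m0) {Y : Ω → ℝ} (hY0 : ∀ ω, 0 ≤ Y ω)
    (hYm : Measurable Y) (hY : Integrable Y P) {c : ℝ} (hc : 0 ≤ c)
    (hle : ∀ᵐ ω ∂P, (P[Y | m]) ω ≤ c) {W : Ω → ℝ≥0∞} (hW : Measurable[m] W) :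
    ∫⁻ ω, W ω * ENNReal.ofReal (Y ω) ∂P ≤ ENNReal.ofReal c * ∫⁻ ω, W ω ∂P := by
  set ν := P.withDensity fun ω => ENNReal.ofReal (Y ω) with hν
  have hYe : Measurable fun ω => ENNReal.ofReal (Y ω) := hYm.ennreal_ofReal
  have hνle : ν.trim hm ≤ ENNReal.ofReal c • P.trim hm := by
    refine Measure.le_iff.mpr fun s hs => ?_
    rw [trim_measurableSet_eq hm hs, Measure.smul_apply, trim_measurableSet_eq hm hs, hν,
      withDensity_apply _ (hm s hs), smul_eq_mul,
      ← ofReal_integral_eq_lintegral_ofReal hY.integrableOn (ae_of_all _ hY0),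
      ← setIntegral_condExp hm hY hs]
    have h1 : ∫ ω in s, (P[Y | m]) ω ∂P ≤ ∫ _ in s, c ∂P :=
      integral_mono_ae integrable_condExp.integrableOn (integrable_const c)
        (ae_restrict_of_ae hle)
    rw [setIntegral_const, smul_eq_mul, mul_comm] at h1
    calc ENNReal.ofReal (∫ ω in s, (P[Y | m]) ω ∂P) ≤ ENNReal.ofReal (c * P.real s) :=
          ENNReal.ofReal_le_ofReal h1
      _ = ENNReal.ofReal c * P s := by rw [ENNReal.ofReal_mul hc, ofReal_measureReal]
  have hW' : Measurable W := hW.mono hm le_rfl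
  calc ∫⁻ ω, W ω * ENNReal.ofReal (Y ω) ∂P = ∫⁻ ω, W ω ∂ν := by
        rw [hν, lintegral_withDensity_eq_lintegral_mul _ hYe hW']
        simp [mul_comm]
    _ = ∫⁻ ω, W ω ∂(ν.trim hm) := (lintegral_trim hm hW).symm
    _ ≤ ∫⁻ ω, W ω ∂(ENNReal.ofReal c • P.trim hm) := lintegral_mono' hνle le_rfl
    _ = ENNReal.ofReal c * ∫⁻ ω, W ω ∂P := by
        rw [lintegral_smul_measure, lintegral_trim hm hW, smul_eq_mul]

theorem ae_eq_zero_of_condSubGaussian_zero (hm : m ≤ m0) {ξ : Ω → ℝ}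
    (h : CondSubGaussian P m ξ 0) : ∀ᵐ ω ∂P, ξ ω = 0 := by
  have hle : ∀ σ : ℝ, ∫ ω, Real.exp (σ * ξ ω) ∂P ≤ 1 := by
    intro σ
    rw [← integral_condExp hm]
    calc ∫ ω, (P[fun ω => Real.exp (σ * ξ ω) | m]) ω ∂P ≤ ∫ _, (1 : ℝ) ∂P := by
          refine integral_mono_ae integrable_condExp (integrable_const _) ?_
          filter_upwards [(h σ).2] with ω hω
          simpa using hω
      _ = 1 := by simp
  have hint := ((h 1).1.add (h (-1)).1).sub (integrable_const (2 : ℝ))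
  have hnonneg : ∀ ω, 0 ≤ Real.exp (1 * ξ ω) + Real.exp (-1 * ξ ω) - 2 := by
    intro ω
    linarith [Real.add_one_le_exp (1 * ξ ω), Real.add_one_le_exp (-1 * ξ ω)]
  have hzero : ∫ ω, (Real.exp (1 * ξ ω) + Real.exp (-1 * ξ ω) - 2) ∂P = 0 := by
    refine le_antisymm ?_ (integral_nonneg hnonneg)
    have h1 : ∫ ω, (Real.exp (1 * ξ ω) + Real.exp (-1 * ξ ω) - 2) ∂P =
        ∫ ω, Real.exp (1 * ξ ω) ∂P + ∫ ω, Real.exp (-1 * ξ ω) ∂P - ∫ _, (2 : ℝ) ∂P := by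
      rw [← integral_add (h 1).1 (h (-1)).1]
      exact integral_sub ((h 1).1.add (h (-1)).1) (integrable_const _)
    have h2 : ∫ _, (2 : ℝ) ∂P = 2 := by simp
    linarith [hle 1, hle (-1)]
  filter_upwards [(integral_eq_zero_iff_of_nonneg hnonneg hint).mp hzero] with ω hω
  by_contra hne
  have h1 := Real.add_one_lt_exp (x := 1 * ξ ω) (by simpa using hne)
  have h2 := Real.add_one_lt_exp (x := -1 * ξ ω) (by simpa using hne)
  have h3 : Real.exp (1 * ξ ω) + Real.exp (-1 * ξ ω) - 2 = 0 := hω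
  linarith

/-- The factor by which the exponential supermartingale grows when the noise value `ξ` is observed
in a direction with predictive mean `μ` and predictive variance `v`. -/
noncomputable def mixtureFactor (μ v ξ : ℝ) : ℝ :=
  Real.exp ((ξ ^ 2 - (ξ - μ) ^ 2 / (1 + v) - Real.log (1 + v)) / 2)

/-- `mixtureFactor` is the Gaussian mixture of the exponentials `exp (g ξ - g² / 2)`. -/
theorem lintegral_gaussianPDF_mul_exp (μ ξ : ℝ) {v : ℝ≥0} (hv : v ≠ 0) :
    ∫⁻ g, gaussianPDF μ v g * ENNReal.ofReal (Real.exp (g * ξ - g ^ 2 / 2)) =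
      ENNReal.ofReal (mixtureFactor μ v ξ) := by
  have hv0 : (0 : ℝ) < v := by positivity
  set v' : ℝ≥0 := v / (1 + v) with hv'
  set μ' : ℝ := (μ + v * ξ) / (1 + v) with hμ'
  have hv'0 : v' ≠ 0 := by positivity
  have hpt : ∀ g, gaussianPDF μ v g * ENNReal.ofReal (Real.exp (g * ξ - g ^ 2 / 2)) =
      ENNReal.ofReal (mixtureFactor μ v ξ) * gaussianPDF μ' v' g := by
    intro g
    rw [gaussianPDF, gaussianPDF, ← ENNReal.ofReal_mul (gaussianPDFReal_nonneg _ _ _),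
      ← ENNReal.ofReal_mul (p := mixtureFactor μ v ξ) (Real.exp_pos _).le]
    congr 1
    have hlog : Real.exp (-Real.log (1 + v) / 2) = (√(1 + (v : ℝ)))⁻¹ := by
      rw [Real.sqrt_eq_rpow, ← Real.rpow_neg (by positivity), Real.rpow_def_of_pos (by positivity)]
      congr 1; ring
    have hsplit : mixtureFactor μ v ξ =
        Real.exp ((ξ ^ 2 - (ξ - μ) ^ 2 / (1 + v)) / 2) * (√(1 + (v : ℝ)))⁻¹ := by
      rw [mixtureFactor, ← hlog, ← Real.exp_add]
      congr 1; ring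
    have hcoe : (v' : ℝ) = v / (1 + v) := by simp [hv']
    rw [gaussianPDFReal, gaussianPDFReal, hsplit, hcoe]
    have hs : √(2 * Real.pi * (v / (1 + v))) = √(2 * Real.pi * v) / √(1 + (v : ℝ)) := by
      rw [← Real.sqrt_div' _ (by positivity)]; congr 1; ring
    have hs1 : 0 < √(1 + (v : ℝ)) := Real.sqrt_pos.mpr (by positivity)
    have hs2 : 0 < √(2 * Real.pi * (v : ℝ)) := Real.sqrt_pos.mpr (by positivity)
    have he : Real.exp (-(g - μ) ^ 2 / (2 * v)) * Real.exp (g * ξ - g ^ 2 / 2) =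
        Real.exp ((ξ ^ 2 - (ξ - μ) ^ 2 / (1 + v)) / 2) *
          Real.exp (-(g - μ') ^ 2 / (2 * (v / (1 + v)))) := by
      rw [← Real.exp_add, ← Real.exp_add, hμ']
      congr 1
      field_simp
      ring
    rw [hs, inv_div, mul_assoc, he]
    field_simp
  simp_rw [hpt]
  rw [lintegral_const_mul _ (measurable_gaussianPDF _ _), lintegral_gaussianPDF_eq_one _ hv'0,
    mul_one]

/-- One step of the method of mixtures. For a fixed slope `g` the factor `exp (g ξ - g² / 2)` has
conditional mean at most one, and Tonelli's theorem transfers this to a Gaussian slope whose mean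
and variance are known in advance. -/
theorem lintegral_mul_mixtureFactor_le (hm : m ≤ m0) {ξ : Ω → ℝ} (hξ : Measurable ξ)
    (h : CondSubGaussian P m ξ 1) {μ : Ω → ℝ} (hμ : Measurable[m] μ) {v : Ω → ℝ≥0}
    (hv : Measurable[m] v) (hμv : ∀ ω, v ω = 0 → μ ω = 0) {W : Ω → ℝ≥0∞} (hW : Measurable[m] W) :
    ∫⁻ ω, W ω * ENNReal.ofReal (mixtureFactor (μ ω) (v ω) (ξ ω)) ∂P ≤ ∫⁻ ω, W ω ∂P := by
  set A : Set Ω := {ω | v ω = 0} with hA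
  have hAm : MeasurableSet[m] A := hv (measurableSet_singleton 0)
  have hW0 : Measurable W := hW.mono hm le_rfl
  have hμ0 : Measurable μ := hμ.mono hm le_rfl
  have hv0 : Measurable v := hv.mono hm le_rfl
  -- the degenerate Gaussian has density zero, so the set where `v = 0` is treated apart
  have hpt : ∀ ω, W ω * ENNReal.ofReal (mixtureFactor (μ ω) (v ω) (ξ ω)) =
      A.indicator W ω + ∫⁻ g : ℝ, W ω * gaussianPDF (μ ω) (v ω) g *
        ENNReal.ofReal (Real.exp (g * ξ ω - g ^ 2 / 2)) := by
    intro ω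
    by_cases hω : v ω = 0
    · have : ω ∈ A := hω
      simp [this, hω, hμv ω hω, mixtureFactor, gaussianPDF]
    · have : ω ∉ A := hω
      simp only [this, not_false_eq_true, Set.indicator_of_notMem, zero_add, mul_assoc]
      rw [lintegral_const_mul _ (by fun_prop), lintegral_gaussianPDF_mul_exp _ _ hω]
  have hpt' : ∀ ω, W ω = A.indicator W ω + ∫⁻ g : ℝ, W ω * gaussianPDF (μ ω) (v ω) g := by
    intro ω
    by_cases hω : v ω = 0
    · have : ω ∈ A := hω
      simp [this, hω, gaussianPDF]
    · have : ω ∉ A := hω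
      rw [lintegral_const_mul _ (measurable_gaussianPDF _ _), lintegral_gaussianPDF_eq_one _ hω]
      simp [this]
  have hpdf : Measurable fun p : Ω × ℝ => gaussianPDF (μ p.1) (v p.1) p.2 :=
    (measurable_uncurry_gaussianPDFReal.comp
      ((hμ0.comp measurable_fst).prodMk
        ((hv0.comp measurable_fst).prodMk measurable_snd))).ennreal_ofReal
  have hpdfg : ∀ g, Measurable[m] fun ω => gaussianPDF (μ ω) (v ω) g := fun g =>
    (measurable_uncurry_gaussianPDFReal.comp
      (hμ.prodMk (hv.prodMk measurable_const))).ennreal_ofReal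
  have hWp : Measurable fun p : Ω × ℝ => W p.1 * gaussianPDF (μ p.1) (v p.1) p.2 :=
    (hW0.comp measurable_fst).mul hpdf
  have hexp : Measurable fun p : Ω × ℝ =>
      ENNReal.ofReal (Real.exp (p.2 * ξ p.1 - p.2 ^ 2 / 2)) := by fun_prop
  have hAW : Measurable (A.indicator W) := hW0.indicator (hm _ hAm)
  calc ∫⁻ ω, W ω * ENNReal.ofReal (mixtureFactor (μ ω) (v ω) (ξ ω)) ∂P
      = ∫⁻ ω, A.indicator W ω ∂P + ∫⁻ ω, (∫⁻ g : ℝ, W ω * gaussianPDF (μ ω) (v ω) g *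
        ENNReal.ofReal (Real.exp (g * ξ ω - g ^ 2 / 2))) ∂P := by
        rw [← lintegral_add_left hAW]; exact lintegral_congr hpt
    _ = ∫⁻ ω, A.indicator W ω ∂P + ∫⁻ g : ℝ, (∫⁻ ω, W ω * gaussianPDF (μ ω) (v ω) g *
        ENNReal.ofReal (Real.exp (g * ξ ω - g ^ 2 / 2)) ∂P) := by
        rw [lintegral_lintegral_swap (hWp.mul hexp).aemeasurable]
    _ ≤ ∫⁻ ω, A.indicator W ω ∂P + ∫⁻ g : ℝ, (∫⁻ ω, W ω * gaussianPDF (μ ω) (v ω) g ∂P) := by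
        refine add_le_add le_rfl (lintegral_mono fun g => ?_)
        have hle : ∀ᵐ ω ∂P, (P[fun ω => Real.exp (g * ξ ω) | m]) ω ≤ Real.exp (g ^ 2 / 2) := by
          simpa using (h g).2
        have hstep := lintegral_mul_le_of_condExp_le hm (fun ω => (Real.exp_pos (g * ξ ω)).le)
          (by fun_prop) (h g).1 (Real.exp_pos _).le hle (hW.mul (hpdfg g))
        calc ∫⁻ ω, W ω * gaussianPDF (μ ω) (v ω) g *
              ENNReal.ofReal (Real.exp (g * ξ ω - g ^ 2 / 2)) ∂P
            = ENNReal.ofReal (Real.exp (-(g ^ 2 / 2))) * ∫⁻ ω, W ω * gaussianPDF (μ ω) (v ω) g *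
              ENNReal.ofReal (Real.exp (g * ξ ω)) ∂P := by
              rw [← lintegral_const_mul' _ _ ENNReal.ofReal_ne_top]
              refine lintegral_congr fun ω => ?_
              rw [sub_eq_add_neg, Real.exp_add, ENNReal.ofReal_mul (Real.exp_pos _).le]
              ring
          _ ≤ ENNReal.ofReal (Real.exp (-(g ^ 2 / 2))) * (ENNReal.ofReal (Real.exp (g ^ 2 / 2)) *
              ∫⁻ ω, W ω * gaussianPDF (μ ω) (v ω) g ∂P) := by gcongr; exact hstep
          _ = ∫⁻ ω, W ω * gaussianPDF (μ ω) (v ω) g ∂P := by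
              rw [← mul_assoc, ← ENNReal.ofReal_mul (Real.exp_pos _).le, ← Real.exp_add]
              simp
    _ = ∫⁻ ω, A.indicator W ω ∂P + ∫⁻ ω, (∫⁻ g : ℝ, W ω * gaussianPDF (μ ω) (v ω) g) ∂P := by
        rw [← lintegral_lintegral_swap hWp.aemeasurable]
    _ = ∫⁻ ω, W ω ∂P := by
        rw [← lintegral_add_left hAW]; exact (lintegral_congr hpt').symm

end SubGaussian

/-! ### Measurability of matrix expressions -/

section Measurability

variable {Ω : Type*} {mΩ : MeasurableSpace Ω} {ι : Type*} [Fintype ι]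

theorem measurable_dotProduct {α β : Ω → ι → ℝ} (hα : ∀ i, Measurable fun ω => α ω i)
    (hβ : ∀ i, Measurable fun ω => β ω i) : Measurable fun ω => α ω ⬝ᵥ β ω :=
  Finset.measurable_sum _ fun i _ => (hα i).mul (hβ i)

theorem measurable_mulVec {A : Ω → Matrix ι ι ℝ} {α : Ω → ι → ℝ}
    (hA : ∀ i j, Measurable fun ω => A ω i j) (hα : ∀ i, Measurable fun ω => α ω i) (i : ι) :
    Measurable fun ω => (A ω *ᵥ α ω) i :=
  measurable_dotProduct (hA i) hα

variable [DecidableEq ι]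

theorem measurable_det {A : Ω → Matrix ι ι ℝ} (hA : ∀ i j, Measurable fun ω => A ω i j) :
    Measurable fun ω => (A ω).det := by
  simp only [det_apply]
  refine Finset.measurable_sum _ fun σ _ => ?_
  exact (Finset.measurable_prod _ fun i _ => hA _ _).const_smul _

theorem measurable_matrix_inv_apply {A : Ω → Matrix ι ι ℝ}
    (hA : ∀ i j, Measurable fun ω => A ω i j) (i j : ι) : Measurable fun ω => (A ω)⁻¹ i j := by
  simp only [inv_def, Matrix.smul_apply, adjugate_apply, Ring.inverse_eq_inv', smul_eq_mul]
  refine (measurable_det hA).inv.mul (measurable_det fun k l => ?_)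
  by_cases hk : k = j
  · subst hk; simp only [updateRow_self]; exact measurable_const
  · simpa only [updateRow_ne hk] using hA k l

variable {H : Type*} [NormedAddCommGroup H] [InnerProductSpace ℝ H] {lam : ℝ}
  {v : Ω → ι → H} {φ : Ω → H} {η : Ω → ι → ℝ}

theorem measurable_inv_ridgeMatrix_apply
    (hv : ∀ i j, Measurable fun ω => inner ℝ (v ω i) (v ω j)) (i j : ι) :
    Measurable fun ω => (ridgeMatrix lam (v ω))⁻¹ i j := by
  refine measurable_matrix_inv_apply (fun k l => ?_) i j
  simp only [ridgeMatrix, Matrix.add_apply, Matrix.gram_apply]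
  exact (hv k l).add_const _

theorem measurable_ridgeVar (hv : ∀ i j, Measurable fun ω => inner ℝ (v ω i) (v ω j))
    (hφ : ∀ i, Measurable fun ω => inner ℝ (φ ω) (v ω i))
    (hφφ : Measurable fun ω => inner ℝ (φ ω) (φ ω)) :
    Measurable fun ω => ridgeVar lam (v ω) (φ ω) := by
  exact (hφφ.const_mul _).sub ((measurable_dotProduct hφ
    (measurable_mulVec (measurable_inv_ridgeMatrix_apply hv) hφ)).const_mul _)

theorem measurable_ridgeMean (hv : ∀ i j, Measurable fun ω => inner ℝ (v ω i) (v ω j))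
    (hφ : ∀ i, Measurable fun ω => inner ℝ (φ ω) (v ω i)) (hη : ∀ i, Measurable fun ω => η ω i) :
    Measurable fun ω => ridgeMean lam (v ω) (η ω) (φ ω) := by
  exact measurable_dotProduct hφ (measurable_mulVec (measurable_inv_ridgeMatrix_apply hv) hη)

theorem measurable_noiseEnergy (hv : ∀ i j, Measurable fun ω => inner ℝ (v ω i) (v ω j))
    (hη : ∀ i, Measurable fun ω => η ω i) :
    Measurable fun ω => noiseEnergy lam (v ω) (η ω) := by
  exact (measurable_dotProduct hη hη).sub ((measurable_dotProduct hη
    (measurable_mulVec (measurable_inv_ridgeMatrix_apply hv) hη)).const_mul _)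

theorem measurable_log_det_one_add_gram
    (hv : ∀ i j, Measurable fun ω => inner ℝ (v ω i) (v ω j)) :
    Measurable fun ω => Real.log (1 + (1 / lam) • Matrix.gram ℝ (v ω)).det := by
  refine Real.measurable_log.comp (measurable_det fun i j => ?_)
  simp only [Matrix.add_apply, Matrix.smul_apply, Matrix.gram_apply]
  exact ((hv i j).const_mul (1 / lam)).const_add _

end Measurability

/-! ### Self-normalized concentration -/

section NoiseBound

variable {H : Type*} [NormedAddCommGroup H] [InnerProductSpace ℝ H]

theorem one_le_det_one_add_gram {lam : ℝ} (hlam : 0 < lam) :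
    ∀ {n : ℕ} (v : Fin n → H), 1 ≤ (1 + (1 / lam) • Matrix.gram ℝ v).det
  | 0, v => by simp
  | n + 1, v => by
    rw [det_one_add_gram_succ hlam]
    exact one_le_mul_of_one_le_of_one_le (one_le_det_one_add_gram hlam _)
      (by linarith [ridgeVar_nonneg hlam (fun i : Fin n => v i.castSucc) (v (Fin.last n))])

theorem log_det_one_add_gram_succ {lam : ℝ} (hlam : 0 < lam) {n : ℕ} (v : Fin (n + 1) → H) :
    Real.log (1 + (1 / lam) • Matrix.gram ℝ v).det =
      Real.log (1 + (1 / lam) • Matrix.gram ℝ fun i : Fin n => v i.castSucc).det +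
      Real.log (1 + ridgeVar lam (fun i : Fin n => v i.castSucc) (v (Fin.last n))) := by
  have h1 := one_le_det_one_add_gram hlam fun i : Fin n => v i.castSucc
  have h2 := ridgeVar_nonneg hlam (fun i : Fin n => v i.castSucc) (v (Fin.last n))
  rw [det_one_add_gram_succ hlam, Real.log_mul (by linarith) (by linarith)]

/-- The exponential of half the excess of the noise energy over the information gain. It is the
mixture of the exponentials `exp ∑ (g_i η_i - g_i² / 2)` over a centred Gaussian vector `g` with
covariance `K / λ`, in closed form. -/
noncomputable def expMart (lam : ℝ) {n : ℕ} (v : Fin n → H) (η : Fin n → ℝ) : ℝ :=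
  Real.exp ((noiseEnergy lam v η - Real.log (1 + (1 / lam) • Matrix.gram ℝ v).det) / 2)

theorem expMart_nonneg (lam : ℝ) {n : ℕ} (v : Fin n → H) (η : Fin n → ℝ) :
    0 ≤ expMart lam v η := (Real.exp_pos _).le

theorem expMart_succ {lam : ℝ} (hlam : 0 < lam) {n : ℕ} (v : Fin (n + 1) → H)
    (η : Fin (n + 1) → ℝ) :
    expMart lam v η = expMart lam (fun i : Fin n => v i.castSucc) (fun i => η i.castSucc) *
      mixtureFactor
        (ridgeMean lam (fun i : Fin n => v i.castSucc) (fun i => η i.castSucc) (v (Fin.last n)))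
        (ridgeVar lam (fun i : Fin n => v i.castSucc) (v (Fin.last n))) (η (Fin.last n)) := by
  rw [expMart, expMart, mixtureFactor, ← Real.exp_add, noiseEnergy_succ hlam,
    log_det_one_add_gram_succ hlam]
  congr 1
  ring

/-- The self-normalized concentration inequality, uniformly over the rounds: `expMart` is a
supermartingale that starts at one. -/
theorem exists_noiseEnergy_le {Ω : Type*} {m0 : MeasurableSpace Ω} (P : Measure Ω)
    [IsProbabilityMeasure P] (F : ℕ → MeasurableSpace Ω) (hmono : Monotone F) (T : ℕ)
    (hF : ∀ n < T, F n ≤ m0) (u : ℕ → Ω → H) (ξ : ℕ → Ω → ℝ)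
    (hu : ∀ n < T, ∀ i ≤ n, ∀ j ≤ n, Measurable[F n] fun ω => inner ℝ (u i ω) (u j ω))
    (hξF : ∀ n < T, ∀ i < n, Measurable[F n] (ξ i)) (hξ : ∀ n < T, Measurable (ξ n))
    (hsub : ∀ n < T, CondSubGaussian P (F n) (ξ n) 1)
    {lam δ : ℝ} (hlam : 0 < lam) (hδ0 : 0 < δ) :
    ∃ G : Set Ω, MeasurableSet G ∧ 1 - δ ≤ P.real G ∧ ∀ ω ∈ G, ∀ n < T,
      noiseEnergy lam (fun i : Fin n => u i ω) (fun i => ξ i ω) ≤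
        Real.log (1 + (1 / lam) • Matrix.gram ℝ fun i : Fin n => u i ω).det - 2 * Real.log δ := by
  set M : ℕ → Ω → ℝ≥0∞ := fun n ω =>
    ENNReal.ofReal (expMart lam (fun i : Fin n => u i ω) (fun i => ξ i ω)) with hMdef
  have hM : ∀ n < T, Measurable[F n] (M n) := by
    intro n hn
    refine Measurable.ennreal_ofReal (Real.measurable_exp.comp (Measurable.div_const
      (Measurable.sub ?_ ?_) 2))
    · exact measurable_noiseEnergy (fun i j => hu n hn _ i.2.le _ j.2.le)
        (fun i => hξF n hn _ i.2)
    · exact measurable_log_det_one_add_gram (fun i j => hu n hn _ i.2.le _ j.2.le)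
  have hsuper : ∀ n < T, ∀ s, MeasurableSet[F n] s → ∫⁻ ω in s, M (n + 1) ω ∂P ≤
      ∫⁻ ω in s, M n ω ∂P := by
    intro n hn s hs
    set μ : Ω → ℝ := fun ω => ridgeMean lam (fun i : Fin n => u i ω) (fun i => ξ i ω) (u n ω)
    set v : Ω → ℝ≥0 := fun ω => (ridgeVar lam (fun i : Fin n => u i ω) (u n ω)).toNNReal
    have hvcoe : ∀ ω, (v ω : ℝ) = ridgeVar lam (fun i : Fin n => u i ω) (u n ω) := fun ω =>
      Real.coe_toNNReal _ (ridgeVar_nonneg hlam _ _)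
    have hμm : Measurable[F n] μ := measurable_ridgeMean
      (fun i j => hu n hn _ i.2.le _ j.2.le) (fun i => hu n hn _ le_rfl _ i.2.le)
      (fun i => hξF n hn _ i.2)
    have hvm : Measurable[F n] v := (measurable_ridgeVar
      (fun i j => hu n hn _ i.2.le _ j.2.le) (fun i => hu n hn _ le_rfl _ i.2.le)
      (hu n hn _ le_rfl _ le_rfl)).real_toNNReal
    have hstep := lintegral_mul_mixtureFactor_le (hF n hn) (hξ n hn) (hsub n hn) hμm hvm
      (fun ω h0 => ridgeMean_eq_zero hlam _ _ _ (by rw [← hvcoe, h0]; rfl))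
      (Measurable.indicator (hM n hn) hs)
    rw [← lintegral_indicator (hF n hn s hs), ← lintegral_indicator (hF n hn s hs)]
    refine le_trans (le_of_eq (lintegral_congr fun ω => ?_)) hstep
    by_cases hω : ω ∈ s
    · simp only [hω, Set.indicator_of_mem, hMdef]
      rw [expMart_succ hlam, ENNReal.ofReal_mul (expMart_nonneg _ _ _), hvcoe]
      rfl
    · simp [hω]
  have hM0 : ∀ ω, M 0 ω = 1 := by
    intro ω
    simp [hMdef, expMart, noiseEnergy]
  have hville := measure_exists_ge_le_of_supermartingale P F hmono T hF M hM hM0 hsuper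
    (ENNReal.ofReal δ⁻¹)
  set N := {ω | ∃ n < T, ENNReal.ofReal δ⁻¹ ≤ M n ω} with hN
  have hNm : MeasurableSet N := by
    have : N = ⋃ n ∈ Finset.range T, {ω | ENNReal.ofReal δ⁻¹ ≤ M n ω} := by
      ext ω; simp [hN]
    rw [this]
    refine Finset.measurableSet_biUnion _ fun n hn => ?_
    have hn' : n < T := by simpa using hn
    exact hF n hn' _ (hM n hn' measurableSet_Ici)
  refine ⟨Nᶜ, hNm.compl, ?_, fun ω hω n hn => ?_⟩
  · rw [probReal_compl_eq_one_sub hNm]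
    have h1 : P N ≤ ENNReal.ofReal δ := by
      have h2 : ENNReal.ofReal δ * (ENNReal.ofReal δ⁻¹ * P N) ≤ ENNReal.ofReal δ * 1 := by
        gcongr
      rwa [← mul_assoc, ← ENNReal.ofReal_mul hδ0.le, mul_inv_cancel₀ hδ0.ne', ENNReal.ofReal_one,
        one_mul, mul_one] at h2
    have h3 : P.real N ≤ δ := ENNReal.toReal_le_of_le_ofReal hδ0.le h1
    linarith
  · have h1 : ¬ ENNReal.ofReal δ⁻¹ ≤ M n ω := fun h => hω ⟨n, hn, h⟩
    have h2 : expMart lam (fun i : Fin n => u i ω) (fun i => ξ i ω) < δ⁻¹ := by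
      by_contra h
      exact h1 (ENNReal.ofReal_le_ofReal (not_lt.mp h))
    rw [expMart, ← Real.lt_log_iff_exp_lt (by positivity), Real.log_inv] at h2
    linarith

/-- The concentration inequality for noise of any sub-Gaussian scale `b ≥ 0`; for `b = 0` the noise
vanishes almost surely. -/
theorem exists_sqrt_noiseEnergy_le {Ω : Type*} {m0 : MeasurableSpace Ω} (P : Measure Ω)
    [IsProbabilityMeasure P] (F : ℕ → MeasurableSpace Ω) (hmono : Monotone F) (T : ℕ)
    (hF : ∀ n < T, F n ≤ m0) (u : ℕ → Ω → H) (ξ : ℕ → Ω → ℝ)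
    (hu : ∀ n < T, ∀ i ≤ n, ∀ j ≤ n, Measurable[F n] fun ω => inner ℝ (u i ω) (u j ω))
    (hξF : ∀ n < T, ∀ i < n, Measurable[F n] (ξ i)) (hξ : ∀ n < T, Measurable (ξ n))
    {b : ℝ} (hb : 0 ≤ b) (hsub : ∀ n < T, CondSubGaussian P (F n) (ξ n) b)
    {lam δ : ℝ} (hlam : 0 < lam) (hδ0 : 0 < δ) :
    ∃ G : Set Ω, MeasurableSet G ∧ 1 - δ ≤ P.real G ∧ ∀ ω ∈ G, ∀ n < T,
      √(noiseEnergy lam (fun i : Fin n => u i ω) (fun i => ξ i ω)) ≤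
        b * √(Real.log (1 + (1 / lam) • Matrix.gram ℝ fun i : Fin n => u i ω).det -
          2 * Real.log δ) := by
  rcases hb.eq_or_lt with rfl | hb
  · have hzero : ∀ᵐ ω ∂P, ∀ n < T, ξ n ω = 0 :=
      ae_all_iff.mpr fun n => by
        by_cases hn : n < T
        · filter_upwards [ae_eq_zero_of_condSubGaussian_zero (hF n hn) (hsub n hn)] with ω hω _
          exact hω
        · exact ae_of_all _ fun ω h => absurd h hn
    obtain ⟨G, hG, hGm, hG1⟩ : ∃ G ⊆ {ω | ∀ n < T, ξ n ω = 0}, MeasurableSet G ∧ P Gᶜ = 0 := by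
      obtain ⟨N, hN, hNm, hN0⟩ := exists_measurable_superset_of_null (ae_iff.mp hzero)
      exact ⟨Nᶜ, fun ω hω => by_contra fun h => hω (hN h), hNm.compl, by simpa using hN0⟩
    refine ⟨G, hGm, ?_, fun ω hω n hn => ?_⟩
    · have : P.real G = 1 := by
        rw [measureReal_def, (prob_compl_eq_zero_iff hGm).mp hG1, ENNReal.toReal_one]
      linarith
    · have h0 : (fun i : Fin n => ξ i ω) = 0 := by
        funext i
        exact hG hω i (i.2.trans hn)
      rw [h0]
      simp [noiseEnergy]
  · obtain ⟨G, hGm, hGP, hG⟩ := exists_noiseEnergy_le P F hmono T hF u (fun n ω => ξ n ω / b) hu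
      (fun n hn i hi => (hξF n hn i hi).div_const b) (fun n hn => (hξ n hn).div_const b)
      (fun n hn => (hsub n hn).div hb) hlam hδ0
    refine ⟨G, hGm, hGP, fun ω hω n hn => ?_⟩
    have hscale : (fun i : Fin n => ξ i ω) = b • fun i : Fin n => ξ i ω / b := by
      funext i
      simp only [Pi.smul_apply, smul_eq_mul]
      field_simp
    rw [hscale, noiseEnergy_smul, Real.sqrt_mul (sq_nonneg b), Real.sqrt_sq hb.le]
    exact mul_le_mul_of_nonneg_left (Real.sqrt_le_sqrt (hG ω hω n hn)) hb.le

end NoiseBound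

/-! ### Widths and regret along a trajectory -/

section Regret

variable {X A H : Type*} [NormedAddCommGroup H] [InnerProductSpace ℝ H]

theorem abs_inner_le_of_inner_self_le_one (f : H) {g : H} (hg : inner ℝ g g ≤ (1 : ℝ)) :
    |inner ℝ f g| ≤ ‖f‖ := by
  have h1 : ‖g‖ ≤ 1 := by
    rw [real_inner_self_eq_norm_sq] at hg
    exact (sq_le_one_iff₀ (norm_nonneg g)).mp hg
  exact (abs_real_inner_le_norm f g).trans (mul_le_of_le_one_right (norm_nonneg f) h1)

/-- A confidence bound turns the regret of the max-min arm into twice its confidence width: the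
optimistic value of the selected arm dominates the optimal worst-case reward. -/
theorem regret_le_of_isMaxMinArm {F U w : X × A → ℝ} {Astar : X → A} {S : Set X} {x : X} {a : A}
    {C : ℝ} (hF : ∀ p, |F p| ≤ C) (hFU : ∀ p, F p ≤ U p) (hUF : ∀ p, U p ≤ F p + 2 * w p)
    (hx : x ∈ S) (ha : IsMaxMinArm U S a) :
    F (x, Astar x) - F (x, a) ≤ MRbar F Astar S + 2 * w (x, a) := by
  have hbelow : ∀ a', BddBelow (Set.range fun x : S => F (x, a')) := fun a' =>
    ⟨-C, by rintro _ ⟨x, rfl⟩; exact (abs_le.mp (hF _)).1⟩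
  have hbelowU : BddBelow (Set.range fun x : S => U (x, a)) :=
    ⟨-C, by rintro _ ⟨x, rfl⟩; exact (abs_le.mp (hF _)).1.trans (hFU _)⟩
  have habove : BddAbove (Set.range fun x : S => F (x, Astar x)) :=
    ⟨C, by rintro _ ⟨x, rfl⟩; exact (abs_le.mp (hF _)).2⟩
  have h1 : F (x, Astar x) ≤ ⨆ x : S, F (x, Astar x) := le_ciSup habove ⟨x, hx⟩
  have h2 : MF F S ≤ U (x, a) := by
    have : Nonempty A := ⟨a⟩
    refine ciSup_le fun a' => ?_
    calc ⨅ x : S, F (x, a') ≤ ⨅ x : S, U (x, a') := ciInf_mono (hbelow a') fun x => hFU _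
      _ ≤ ⨅ x : S, U (x, a) := ha a'
      _ ≤ U (x, a) := ciInf_le hbelowU ⟨x, hx⟩
  have h3 := hUF (x, a)
  rw [MRbar]
  linarith

variable {Z : Type*} (φ : Z → H) (z : ℕ → Z) (y : ℕ → ℝ) {lam : ℝ}

theorem infoGain_succ (hlam : 0 < lam) (t : ℕ) :
    infoGain (fun p q => inner ℝ (φ p) (φ q)) z lam (t + 2) =
      infoGain (fun p q => inner ℝ (φ p) (φ q)) z lam (t + 1) +
      Real.log (1 + widthSq (fun p q => inner ℝ (φ p) (φ q)) z lam (t + 1) (z (t + 1))) :=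
  log_det_one_add_gram_succ hlam fun i : Fin (t + 1) => φ (z (i + 1))

theorem widthSq_nonneg (hlam : 0 < lam) (t : ℕ) (p : Z) :
    0 ≤ widthSq (fun p q => inner ℝ (φ p) (φ q)) z lam t p :=
  ridgeVar_nonneg hlam (fun i : Fin (t - 1) => φ (z (i + 1))) (φ p)

theorem widthSq_le_one (hφ : ∀ p, inner ℝ (φ p) (φ p) ≤ (1 : ℝ)) (hlam : 1 ≤ lam) (t : ℕ) (p : Z) :
    widthSq (fun p q => inner ℝ (φ p) (φ q)) z lam t p ≤ 1 := by
  refine (ridgeVar_le (by linarith) (fun i : Fin (t - 1) => φ (z (i + 1))) (φ p)).trans ?_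
  exact mul_le_one₀ (by rw [one_div]; exact inv_le_one_of_one_le₀ hlam) real_inner_self_nonneg (hφ p)

theorem infoGain_mono (hlam : 0 < lam) :
    Monotone fun t => infoGain (fun p q => inner ℝ (φ p) (φ q)) z lam t := by
  refine monotone_nat_of_le_succ fun t => ?_
  cases t with
  -- rounds `0` and `1` both have an empty Gram matrix, since `t - 1` truncates
  | zero => exact le_rfl
  | succ t =>
    have h := Real.log_nonneg (x := 1 + widthSq (fun p q => inner ℝ (φ p) (φ q)) z lam (t + 1)
      (z (t + 1))) (by linarith [widthSq_nonneg φ z hlam (t + 1) (z (t + 1))])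
    linarith [infoGain_succ φ z hlam t]

theorem hcoef_mono (hlam : 0 < lam) (B : ℝ) {b : ℝ} (hb : 0 ≤ b) (δ : ℝ) :
    Monotone fun t => hcoef (fun p q => inner ℝ (φ p) (φ q)) z lam B b δ t := fun _ _ hst =>
  add_le_add_right (mul_le_mul_of_nonneg_left
    (Real.sqrt_le_sqrt (sub_le_sub_right (infoGain_mono φ z hlam hst) _)) hb) _

theorem hcoef_nonneg {B b : ℝ} (hB : 0 ≤ B) (hb : 0 ≤ b) (δ : ℝ) (t : ℕ) (k : Z → Z → ℝ) :
    0 ≤ hcoef k z lam B b δ t := by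
  unfold hcoef; positivity

theorem sum_log_one_add_widthSq (hlam : 0 < lam) (T : ℕ) :
    ∑ t ∈ Finset.Icc 1 T,
      Real.log (1 + widthSq (fun p q => inner ℝ (φ p) (φ q)) z lam t (z t)) =
      infoGain (fun p q => inner ℝ (φ p) (φ q)) z lam (T + 1) := by
  induction T with
  | zero => simp [infoGain]
  | succ T ih => rw [Finset.sum_Icc_succ_top (by omega), ih, infoGain_succ φ z hlam]

theorem infoGain_le (hφ : ∀ p, inner ℝ (φ p) (φ p) ≤ (1 : ℝ)) (hlam : 0 < lam) (T : ℕ) :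
    infoGain (fun p q => inner ℝ (φ p) (φ q)) z lam (T + 1) ≤
      (gram (fun p q => inner ℝ (φ p) (φ q)) z (T + 1)).rank *
        Real.log (1 + T / ((gram (fun p q => inner ℝ (φ p) (φ q)) z (T + 1)).rank * lam)) := by
  refine log_det_one_add_smul_le hlam
    (Matrix.posSemidef_gram ℝ fun i : Fin T => φ (z (i + 1))) ?_ T.cast_nonneg
  calc (Matrix.gram ℝ fun i : Fin T => φ (z (i + 1))).trace ≤ ∑ _i : Fin T, (1 : ℝ) :=
        Finset.sum_le_sum fun i _ => hφ _
    _ = T := by simp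

/-- The elliptical potential bound: the widths along the trajectory are controlled by the
information gain, because `s² ≤ 2 log (1 + s²)` on the unit interval. -/
theorem sum_width_le (hφ : ∀ p, inner ℝ (φ p) (φ p) ≤ (1 : ℝ)) (hlam : 1 ≤ lam) (T : ℕ) :
    ∑ t ∈ Finset.Icc 1 T, width (fun p q => inner ℝ (φ p) (φ q)) z lam t (z t) ≤
      √(2 * T * (gram (fun p q => inner ℝ (φ p) (φ q)) z (T + 1)).rank *
        Real.log (1 + T / ((gram (fun p q => inner ℝ (φ p) (φ q)) z (T + 1)).rank * lam))) := by
  have hlam0 : 0 < lam := by linarith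
  have hsq : ∀ t, width (fun p q => inner ℝ (φ p) (φ q)) z lam t (z t) ^ 2 ≤
      2 * Real.log (1 + widthSq (fun p q => inner ℝ (φ p) (φ q)) z lam t (z t)) := by
    intro t
    have h0 := widthSq_nonneg φ z hlam0 t (z t)
    have h1 := widthSq_le_one φ z hφ hlam t (z t)
    rw [width, Real.sq_sqrt h0]
    set s := widthSq (fun p q => inner ℝ (φ p) (φ q)) z lam t (z t)
    have h2 := Real.one_sub_inv_le_log_of_pos (x := 1 + s) (by linarith)
    have h3 : s / 2 ≤ 1 - (1 + s)⁻¹ := by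
      have : 1 - (1 + s)⁻¹ = s / (1 + s) := by field_simp; ring
      rw [this]
      exact div_le_div_of_nonneg_left h0 (by linarith) (by linarith)
    linarith
  apply Real.le_sqrt_of_sq_le
  calc (∑ t ∈ Finset.Icc 1 T, width (fun p q => inner ℝ (φ p) (φ q)) z lam t (z t)) ^ 2
      ≤ (Finset.Icc 1 T).card *
        ∑ t ∈ Finset.Icc 1 T, width (fun p q => inner ℝ (φ p) (φ q)) z lam t (z t) ^ 2 :=
        sq_sum_le_card_mul_sum_sq
    _ ≤ T * (2 * infoGain (fun p q => inner ℝ (φ p) (φ q)) z lam (T + 1)) := by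
        rw [Nat.card_Icc, Nat.add_sub_cancel]
        refine mul_le_mul_of_nonneg_left ?_ T.cast_nonneg
        rw [← sum_log_one_add_widthSq φ z hlam0, Finset.mul_sum]
        exact Finset.sum_le_sum fun t _ => hsq t
    _ ≤ T * (2 * ((gram (fun p q => inner ℝ (φ p) (φ q)) z (T + 1)).rank * Real.log (1 + T /
        ((gram (fun p q => inner ℝ (φ p) (φ q)) z (T + 1)).rank * lam)))) := by
        gcongr
        exact infoGain_le φ z hφ hlam0 T
    _ = _ := by ring

/-- On the event of small self-normalized noise, the confidence interval of radius `h_t s_t(p)`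
contains the reward at every point `p` simultaneously. -/
theorem abs_inner_sub_fhat_le (hlam : 0 < lam) {f : H} {B b δ : ℝ} (hf : ‖f‖ ≤ B) {n : ℕ → ℝ}
    {t : ℕ} (hy : ∀ i : Fin (t - 1), y (i + 1) = inner ℝ f (φ (z (i + 1))) + n (i + 1))
    (hn : √(noiseEnergy lam (fun i : Fin (t - 1) => φ (z (i + 1))) fun i => n (i + 1)) ≤
      b * √(infoGain (fun p q => inner ℝ (φ p) (φ q)) z lam t - 2 * Real.log δ)) (p : Z) :
    |inner ℝ f (φ p) - fhat (fun p q => inner ℝ (φ p) (φ q)) z y lam t p| ≤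
      hcoef (fun p q => inner ℝ (φ p) (φ q)) z lam B b δ t *
        width (fun p q => inner ℝ (φ p) (φ q)) z lam t p := by
  have h := abs_inner_sub_ridgeMean_le hlam (fun i : Fin (t - 1) => φ (z (i + 1)))
    (fun i => n (i + 1)) f (φ p)
  rw [← funext hy] at h
  refine h.trans (mul_le_mul_of_nonneg_right ?_ (Real.sqrt_nonneg _))
  exact add_le_add (mul_le_mul_of_nonneg_left hf (Real.sqrt_nonneg _)) hn

/-- The regret bound on every trajectory along which the self-normalized noise is small. -/
theorem sum_regret_le (φ : X × A → H) (hφ : ∀ p, inner ℝ (φ p) (φ p) ≤ (1 : ℝ)) {f : H}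
    {B b δ : ℝ} (hf : ‖f‖ ≤ B) (hb : 0 ≤ b) (hlam : 1 ≤ lam) (Astar : X → A) (S : ℕ → Set X)
    (T : ℕ) (x : ℕ → X) (a : ℕ → A) (y n : ℕ → ℝ)
    (hy : ∀ t ∈ Finset.Icc 1 T, y t = inner ℝ f (φ (x t, a t)) + n t)
    (hn : ∀ t ∈ Finset.Icc 1 T,
      √(noiseEnergy lam (fun i : Fin (t - 1) => φ (x (i + 1), a (i + 1))) fun i => n (i + 1)) ≤
      b * √(infoGain (fun p q => inner ℝ (φ p) (φ q)) (fun τ => (x τ, a τ)) lam t -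
        2 * Real.log δ))
    (hx : ∀ t ∈ Finset.Icc 1 T, x t ∈ S t)
    (ha : ∀ t ∈ Finset.Icc 1 T, IsMaxMinArm
      (ucb (fun p q => inner ℝ (φ p) (φ q)) (fun τ => (x τ, a τ)) y lam B b δ t) (S t) (a t)) :
    ∑ t ∈ Finset.Icc 1 T, (inner ℝ f (φ (x t, Astar (x t))) - inner ℝ f (φ (x t, a t))) ≤
      ∑ t ∈ Finset.Icc 1 T, MRbar (fun p => inner ℝ f (φ p)) Astar (S t) +
      2 * hcoef (fun p q => inner ℝ (φ p) (φ q)) (fun τ => (x τ, a τ)) lam B b δ T *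
        √(2 * T * (gram (fun p q => inner ℝ (φ p) (φ q)) (fun τ => (x τ, a τ)) (T + 1)).rank *
          Real.log (1 + T /
            ((gram (fun p q => inner ℝ (φ p) (φ q)) (fun τ => (x τ, a τ)) (T + 1)).rank *
              lam))) := by
  have hlam0 : 0 < lam := by linarith
  have hB : 0 ≤ B := (norm_nonneg f).trans hf
  set z : ℕ → X × A := fun τ => (x τ, a τ)
  set k : X × A → X × A → ℝ := fun p q => inner ℝ (φ p) (φ q)
  have hround : ∀ t ∈ Finset.Icc 1 T,
      inner ℝ f (φ (x t, Astar (x t))) - inner ℝ f (φ (x t, a t)) ≤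
        MRbar (fun p => inner ℝ f (φ p)) Astar (S t) +
          2 * hcoef k z lam B b δ T * width k z lam t (z t) := by
    intro t ht
    obtain ⟨ht1, htT⟩ := Finset.mem_Icc.mp ht
    have hconf : ∀ p, |inner ℝ f (φ p) - fhat k z y lam t p| ≤
        hcoef k z lam B b δ t * width k z lam t p :=
      abs_inner_sub_fhat_le φ z y hlam0 hf
        (fun i => hy _ (Finset.mem_Icc.mpr ⟨by omega, by have := i.2; omega⟩)) (hn t ht)
    have h := regret_le_of_isMaxMinArm (F := fun p => inner ℝ f (φ p)) (Astar := Astar)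
      (w := fun p => hcoef k z lam B b δ t * width k z lam t p)
      (fun p => abs_inner_le_of_inner_self_le_one f (hφ p))
      (fun p => by have := (abs_le.mp (hconf p)).2; simp only [ucb]; linarith)
      (fun p => by have := (abs_le.mp (hconf p)).1; simp only [ucb]; linarith)
      (hx t ht) (ha t ht)
    refine h.trans (add_le_add_right ?_ _)
    rw [← mul_assoc]
    exact mul_le_mul_of_nonneg_right (mul_le_mul_of_nonneg_left
      (hcoef_mono φ z hlam0 B hb δ htT) zero_le_two) (Real.sqrt_nonneg _)
  calc _ ≤ ∑ t ∈ Finset.Icc 1 T, (MRbar (fun p => inner ℝ f (φ p)) Astar (S t) +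
          2 * hcoef k z lam B b δ T * width k z lam t (z t)) := Finset.sum_le_sum hround
    _ ≤ _ := by
      rw [Finset.sum_add_distrib, ← Finset.mul_sum]
      have := hcoef_nonneg (lam := lam) z hB hb δ T k
      gcongr
      exact sum_width_le φ z hφ hlam T

end Regret

/-! ### Reproducing kernels -/

section ReproducingKernel

variable {H Z : Type*} [NormedAddCommGroup H] [InnerProductSpace ℝ H] [CompleteSpace H]
  [RKHS ℝ H Z ℝ]

theorem scalarKernel_eq_inner (p q : Z) :
    scalarKernel H p q = inner ℝ (RKHS.kerFun H p (1 : ℝ)) (RKHS.kerFun H q (1 : ℝ)) := by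
  rw [real_inner_comm, ← RKHS.kernel_inner]
  simp [scalarKernel]

theorem apply_eq_inner (f : H) (p : Z) : f p = inner ℝ f (RKHS.kerFun H p (1 : ℝ)) := by
  simp

/-- The functions of the space are pointwise limits of combinations of kernel sections. -/
theorem measurable_of_measurable_scalarKernel [MeasurableSpace Z]
    (hk : Measurable fun p : Z × Z => scalarKernel H p.1 p.2) (f : H) : Measurable (f : Z → ℝ) := by
  have hspan : ∀ g ∈ Submodule.span ℝ {g : H | ∃ x v, RKHS.kerFun H x v = g},
      Measurable (g : Z → ℝ) := by
    intro g hg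
    induction hg using Submodule.span_induction with
    | mem g hg =>
      obtain ⟨q, c, rfl⟩ := hg
      have : (RKHS.kerFun H q c : Z → ℝ) = fun p => c * scalarKernel H p q := by
        funext p
        have hc : RKHS.kerFun H q c = c • RKHS.kerFun H q (1 : ℝ) := by
          rw [← map_smul, smul_eq_mul, mul_one]
        rw [RKHS.kerFun_apply, scalarKernel, ← smul_eq_mul, ← map_smul, smul_eq_mul, mul_one]
      rw [this]
      exact (hk.comp (measurable_id.prodMk measurable_const)).const_mul c
    | zero => rw [RKHS.coe_zero]; exact measurable_const
    | add g h _ _ hg hh => rw [RKHS.coe_add]; exact hg.add hh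
    | smul c g _ hg => rw [RKHS.coe_smul]; exact hg.const_smul c
  have hf : f ∈ closure (Submodule.span ℝ {g : H | ∃ x v, RKHS.kerFun H x v = g} : Set H) := by
    rw [← Submodule.topologicalClosure_coe, RKHS.kerFun_dense]
    trivial
  obtain ⟨g, hg, hgf⟩ := mem_closure_iff_seq_limit.mp hf
  exact measurable_of_tendsto_metrizable (fun i => hspan _ (hg i))
    (tendsto_pi_nhds.mpr fun p => ((RKHS.continuous_eval p).tendsto f).comp hgf)

end ReproducingKernel

/-! ### The filtration of the rounds -/

section Information

variable {Ω X A : Type*} [MeasurableSpace X] [MeasurableSpace A] (x : ℕ → Ω → X) (a : ℕ → Ω → A)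
  (y : ℕ → Ω → ℝ)

theorem information_mono : Monotone (information x a y) := by
  intro s t hst
  refine sup_le_sup ?_ ?_
  · exact biSup_mono fun τ hτ => by simp only [Finset.mem_Icc] at hτ ⊢; omega
  · exact biSup_mono fun τ hτ => by simp only [Finset.mem_Icc] at hτ ⊢; omega

theorem information_le {mΩ : MeasurableSpace Ω} {t : ℕ}
    (hx : ∀ τ ∈ Finset.Icc 1 t, Measurable (x τ)) (ha : ∀ τ ∈ Finset.Icc 1 t, Measurable (a τ))
    (hy : ∀ τ ∈ Finset.Icc 1 (t - 1), Measurable (y τ)) : information x a y t ≤ mΩ :=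
  sup_le (iSup₂_le fun τ hτ => ((hx τ hτ).prodMk (ha τ hτ)).comap_le)
    (iSup₂_le fun τ hτ => (hy τ hτ).comap_le)

theorem measurable_pair_information {τ t : ℕ} (hτ : τ ∈ Finset.Icc 1 t) :
    Measurable[information x a y t] fun ω => (x τ ω, a τ ω) :=
  Measurable.of_comap_le (le_sup_of_le_left (le_iSup₂_of_le τ hτ le_rfl))

theorem measurable_reward_information {τ t : ℕ} (hτ : τ ∈ Finset.Icc 1 (t - 1)) :
    Measurable[information x a y t] (y τ) :=
  Measurable.of_comap_le (le_sup_of_le_right (le_iSup₂_of_le τ hτ le_rfl))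

end Information

end RobustBandit

theorem mainTheorem2
    {E F : Type*}
    [NormedAddCommGroup E] [NormedSpace ℝ E] [FiniteDimensional ℝ E]
    [MeasurableSpace E] [BorelSpace E]
    [NormedAddCommGroup F] [NormedSpace ℝ F] [FiniteDimensional ℝ F]
    [MeasurableSpace F] [BorelSpace F]
    -- contexts and arms
    (𝒳 : Set E) (𝒜 : Set F)
    -- the reproducing kernel Hilbert space and the reward function
    {H : Type*} [NormedAddCommGroup H] [InnerProductSpace ℝ H] [CompleteSpace H]
    [RKHS ℝ H (𝒳 × 𝒜) ℝ]
    (hk_meas : Measurable fun p : (𝒳 × 𝒜) × (𝒳 × 𝒜) => scalarKernel H p.1 p.2)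
    (hk_le : ∀ p : 𝒳 × 𝒜, scalarKernel H p p ≤ 1)
    (B : ℝ) (f : H) (hf : ‖f‖ ≤ B)
    -- the oracle-optimal arms
    (Astar : 𝒳 → 𝒜) (hAstar : IsOracle f Astar)
    -- parameters
    (lam b δ Δ : ℝ) (hlam : 1 ≤ lam) (hb : 0 ≤ b) (hδ0 : 0 < δ) (hδ1 : δ < 1) (T : ℕ)
    -- received contexts, true contexts, selected arms, rewards, noise
    {Ω : Type*} [MeasurableSpace Ω] (P : Measure Ω) [IsProbabilityMeasure P]
    (xhat x : ℕ → Ω → 𝒳) (a : ℕ → Ω → 𝒜) (y n : ℕ → Ω → ℝ)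
    (hx_meas : ∀ t ∈ Finset.Icc 1 T, Measurable (x t))
    (ha_meas : ∀ t ∈ Finset.Icc 1 T, Measurable (a t))
    (hy_meas : ∀ t ∈ Finset.Icc 1 T, Measurable (y t))
    (hy : ∀ t ∈ Finset.Icc 1 T, ∀ ω, y t ω = f (x t ω, a t ω) + n t ω)
    (hn : ∀ t ∈ Finset.Icc 1 T, CondSubGaussian P (information x a y t) (n t) b)
    -- the true context lies in the defense region
    (hx : ∀ t ∈ Finset.Icc 1 T, ∀ ω, x t ω ∈ ball Δ (xhat t ω))
    -- the arms are selected by MaxMinUCB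
    (ha : ∀ t ∈ Finset.Icc 1 T, ∀ ω,
      IsMaxMinArm
        (ucb (scalarKernel H) (fun τ => (x τ ω, a τ ω)) (fun τ => y τ ω) lam B b δ t)
        (ball Δ (xhat t ω)) (a t ω)) :
    ∃ G : Set Ω, MeasurableSet G ∧ 1 - δ ≤ P.real G ∧ ∀ ω ∈ G,
      ∀ d : ℕ, d = (gram (scalarKernel H) (fun τ => (x τ ω, a τ ω)) (T + 1)).rank →
        ∑ t ∈ Finset.Icc 1 T, (f (x t ω, Astar (x t ω)) - f (x t ω, a t ω)) ≤
          ∑ t ∈ Finset.Icc 1 T, MRbar f Astar (ball Δ (xhat t ω)) +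
          2 * hcoef (scalarKernel H) (fun τ => (x τ ω, a τ ω)) lam B b δ T *
            √(2 * T * d * Real.log (1 + T / (d * lam))) := by
  set φ : 𝒳 × 𝒜 → H := fun p => RKHS.kerFun H p (1 : ℝ) with hφdef
  have hk : scalarKernel H = fun p q : 𝒳 × 𝒜 => inner ℝ (φ p) (φ q) := by
    funext p q
    exact scalarKernel_eq_inner p q
  have hfφ : (f : 𝒳 × 𝒜 → ℝ) = fun p => inner ℝ f (φ p) := funext (apply_eq_inner f)
  have hfm : Measurable (f : 𝒳 × 𝒜 → ℝ) := measurable_of_measurable_scalarKernel hk_meas f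
  have hlam0 : 0 < lam := by linarith
  have hIcc : ∀ {i : ℕ}, i < T → i + 1 ∈ Finset.Icc 1 T := fun hi =>
    Finset.mem_Icc.mpr ⟨by omega, hi⟩
  have hnoise : ∀ i < T, n (i + 1) = fun ω => y (i + 1) ω - f (x (i + 1) ω, a (i + 1) ω) :=
    fun i hi => funext fun ω => by rw [hy _ (hIcc hi) ω]; ring
  obtain ⟨G, hGm, hGP, hG⟩ := exists_sqrt_noiseEnergy_le P
    (fun i => information x a y (i + 1))
    (fun i j hij => information_mono x a y (Nat.succ_le_succ hij)) T
    (fun i hi => information_le x a y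
      (fun τ hτ => hx_meas τ (Finset.Icc_subset_Icc_right hi hτ))
      (fun τ hτ => ha_meas τ (Finset.Icc_subset_Icc_right hi hτ))
      (fun τ hτ => hy_meas τ (Finset.Icc_subset_Icc_right (by omega) hτ)))
    (fun i ω => φ (x (i + 1) ω, a (i + 1) ω)) (fun i => n (i + 1))
    (fun t _ i hi j hj => by
      have h := hk_meas.comp
        ((measurable_pair_information x a y (τ := i + 1) (t := t + 1)
          (Finset.mem_Icc.mpr ⟨by omega, by omega⟩)).prodMk
        (measurable_pair_information x a y (τ := j + 1) (t := t + 1)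
          (Finset.mem_Icc.mpr ⟨by omega, by omega⟩)))
      rw [hk] at h
      exact h)
    (fun t ht i hi => by
      rw [hnoise i (hi.trans ht)]
      exact (measurable_reward_information x a y
        (Finset.mem_Icc.mpr ⟨by omega, by omega⟩)).sub
        (hfm.comp (measurable_pair_information x a y
          (Finset.mem_Icc.mpr ⟨by omega, by omega⟩))))
    (fun t ht => by
      rw [hnoise t ht]
      exact (hy_meas _ (hIcc ht)).sub
        (hfm.comp ((hx_meas _ (hIcc ht)).prodMk (ha_meas _ (hIcc ht)))))
    hb (fun t ht => hn _ (hIcc ht)) hlam0 hδ0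
  refine ⟨G, hGm, hGP, fun ω hω d hd => ?_⟩
  subst hd
  rw [hk] at ha ⊢
  rw [hfφ] at hy ⊢
  refine sum_regret_le φ (fun p => ?_) hf hb hlam Astar (fun t => ball Δ (xhat t ω)) T
    (fun t => x t ω) (fun t => a t ω) (fun t => y t ω) (fun t => n t ω)
    (fun t ht => hy t ht ω) (fun t ht => ?_) (fun t ht => hx t ht ω) (fun t ht => ha t ht ω)
  · exact (scalarKernel_eq_inner p p).symm.trans_le (hk_le p)
  · obtain ⟨ht1, htT⟩ := Finset.mem_Icc.mp ht
    exact hG ω hω (t - 1) (by omega)
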